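/- Let $\mathcal Q_2$ be the universal unital C*-algebra generated by a unitary $U$ and an isometry $S_2$ with $S_2U=U^2S_2$ and $S_2S_2^*+US_2S_2^*U^*=1$. Let $\mathcal O_2$ be the Cuntz algebra, the universal unital C*-algebra generated by two isometries $S_1,S_2$ with $S_1S_1^*+S_2S_2^*=1$, mapped into $\mathcal Q_2$ by the embedding $S_1\mapsto US_2$, $S_2\mapsto S_2$. Let $\rho_c$ be the canonical representation of $\mathcal Q_2$ on $\ell^2(\mathbb Z)$, $\rho_c(U)e_k=e_{k+1}$, $\rho_c(S_2)e_k=e_{2k}$, and let $\pi_+$ and $\pi_-$ be the restrictions of $\rho_c|_{\mathcal O_2}$ to its invariant subspaces $\mathcal H_+=\overline{\mathrm{span}}\{e_k:k\ge 0\}$ and $\mathcal H_-=\overline{\mathrm{span}}\{e_k:k<0\}$. For $i\in\{1,2\}$, a representation $\pi$ of $\mathcal O_2$ on a Hilbert space $\mathcal H$ is said to be of type $P(i)$ if there are an orthonormal basis $(e_n)_{n\in\mathbb N}$ of $\mathcal H$ and injections $\sigma_1,\sigma_2:\mathbb N\to\mathbb N$, whose ranges are disjoint with union $\mathbb N$,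 such that $\pi(S_j)e_n=e_{\sigma_j(n)}$ for $j=1,2$ and all $n$, and if some basis vector $e_n$ is cyclic for $\pi$ and satisfies $\pi(S_i)e_n=e_n$. Theorem. The representation $\pi_-$ is of type $P(1)$ and $\pi_+$ is of type $P(2)$. If $\pi:\mathcal O_2\to\mathcal B(\mathcal H)$ is any representation of type $P(1)$ or $P(2)$ and $x\in\mathcal H$ is a unit vector, then the vector state $\omega_x(T)=(\pi(T)x,x)$, $T\in\mathcal O_2$, is a pure state of $\mathcal O_2$ and has the unique extension property: there is exactly one pure state $\Omega$ of $\mathcal Q_2$ whose restriction to $\mathcal O_2$ is $\omega_x$. -/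

import Mathlib

open scoped InnerProductSpace ComplexOrder

noncomputable section

/-! ### The free unital `*`-algebra -/

/-- The free unital complex `*`-algebra on `X`: the free algebra on the letters `x` (`Sum.inl x`)
and the formal adjoints `x*` (`Sum.inr x`). -/
def FreeStarAlg (X : Type) : Type := FreeAlgebra ℂ (X ⊕ X)

/-- The opposite of a complex algebra, with conjugated scalar multiplication. -/
def ConjOp (A : Type) : Type := Aᵐᵒᵖ

instance (A : Type) [Ring A] : Ring (ConjOp A) := inferInstanceAs (Ring Aᵐᵒᵖ)

instance (A : Type) [Ring A] [Algebra ℂ A] : Algebra ℂ (ConjOp A) :=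
  RingHom.toAlgebra' (((algebraMap ℂ Aᵐᵒᵖ).comp (starRingEnd ℂ) : ℂ →+* Aᵐᵒᵖ))
    (fun c x => Algebra.commutes (A := Aᵐᵒᵖ) (starRingEnd ℂ c) x)

namespace FreeStarAlg

variable {X : Type}

instance : Ring (FreeStarAlg X) := inferInstanceAs (Ring (FreeAlgebra ℂ (X ⊕ X)))

instance : Algebra ℂ (FreeStarAlg X) := inferInstanceAs (Algebra ℂ (FreeAlgebra ℂ (X ⊕ X)))

/-- The letter `x`. -/
def gen (x : X) : FreeStarAlg X := FreeAlgebra.ι ℂ (Sum.inl x : X ⊕ X)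

/-- The letter `x*`. -/
def genStar (x : X) : FreeStarAlg X := FreeAlgebra.ι ℂ (Sum.inr x : X ⊕ X)

/-- The algebra homomorphism determined by values on the letters `x` and `x*`. -/
def liftAlg {B : Type*} [Ring B] [Algebra ℂ B] (f g : X → B) : FreeStarAlg X →ₐ[ℂ] B :=
  FreeAlgebra.lift ℂ (Sum.elim f g)

@[simp] theorem liftAlg_gen {B : Type*} [Ring B] [Algebra ℂ B] (f g : X → B) (x : X) :
    liftAlg f g (gen x) = f x := FreeAlgebra.lift_ι_apply _ _

@[simp] theorem liftAlg_genStar {B : Type*} [Ring B] [Algebra ℂ B] (f g : X → B) (x : X) :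
    liftAlg f g (genStar x) = g x := FreeAlgebra.lift_ι_apply _ _

theorem induct {P : FreeStarAlg X → Prop} (h₀ : ∀ c : ℂ, P (algebraMap ℂ _ c))
    (h₁ : ∀ x, P (gen x)) (h₂ : ∀ x, P (genStar x)) (hm : ∀ a b, P a → P b → P (a * b))
    (ha : ∀ a b, P a → P b → P (a + b)) (a : FreeStarAlg X) : P a :=
  FreeAlgebra.induction (R := ℂ) (X := X ⊕ X) (motive := P) h₀
    (fun y => y.casesOn h₁ h₂) hm ha a

/-- The algebra homomorphism to the conjugate opposite algebra that exchanges `x` and `x*`. -/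
def starAux : FreeStarAlg X →ₐ[ℂ] ConjOp (FreeStarAlg X) :=
  liftAlg (fun x => (MulOpposite.op (genStar x) : (FreeStarAlg X)ᵐᵒᵖ))
    (fun x => (MulOpposite.op (gen x) : (FreeStarAlg X)ᵐᵒᵖ))

/-- The conjugate-linear anti-multiplicative involution exchanging `x` and `x*`. -/
instance : Star (FreeStarAlg X) :=
  ⟨fun a => MulOpposite.unop (starAux a : (FreeStarAlg X)ᵐᵒᵖ)⟩

@[simp] theorem star_gen (x : X) : star (gen x) = genStar x :=
  congrArg MulOpposite.unop (liftAlg_gen (B := ConjOp (FreeStarAlg X)) _ _ x)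

@[simp] theorem star_genStar (x : X) : star (genStar x) = gen x :=
  congrArg MulOpposite.unop (liftAlg_genStar (B := ConjOp (FreeStarAlg X)) _ _ x)

theorem star_add' (a b : FreeStarAlg X) : star (a + b) = star a + star b :=
  congrArg MulOpposite.unop (map_add starAux a b)

theorem star_mul' (a b : FreeStarAlg X) : star (a * b) = star b * star a :=
  congrArg MulOpposite.unop (map_mul starAux a b)

theorem star_algebraMap' (c : ℂ) :
    star (algebraMap ℂ (FreeStarAlg X) c) = algebraMap ℂ _ (star c) :=
  congrArg MulOpposite.unop (starAux.commutes c)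

instance : StarRing (FreeStarAlg X) where
  star_involutive a := by
    induction a using induct with
    | h₀ c => simp [star_algebraMap']
    | h₁ x => simp
    | h₂ x => simp
    | hm a b h h' => rw [star_mul', star_mul', h, h']
    | ha a b h h' => rw [star_add', star_add', h, h']
  star_mul := star_mul'
  star_add := star_add'

instance : StarModule ℂ (FreeStarAlg X) where
  star_smul c a := by
    rw [Algebra.smul_def, star_mul, star_algebraMap', Algebra.smul_def, Algebra.commutes]

/-- Evaluation of `*`-polynomials at a family of elements of a `*`-algebra. -/
def eval {B : Type*} [Ring B] [StarRing B] [Algebra ℂ B] [StarModule ℂ B] (b : X → B) :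
    FreeStarAlg X →⋆ₐ[ℂ] B :=
  { liftAlg b (fun x => star (b x)) with
    map_star' := fun a => by
      change liftAlg b (fun x => star (b x)) (star a) = star (liftAlg b (fun x => star (b x)) a)
      induction a using induct with
      | h₀ c => rw [star_algebraMap', AlgHom.commutes, AlgHom.commutes, algebraMap_star_comm]
      | h₁ x => simp
      | h₂ x => simp
      | hm a b h h' => rw [star_mul, map_mul, map_mul, star_mul, h, h']
      | ha a b h h' => rw [star_add, map_add, map_add, star_add, h, h'] }

@[simp] theorem eval_gen {B : Type*} [Ring B] [StarRing B] [Algebra ℂ B] [StarModule ℂ B]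
    (b : X → B) (x : X) : eval b (gen x) = b x := liftAlg_gen _ _ x

end FreeStarAlg

/-! ### Universal C*-algebras -/

/-- A C*-seminorm on the free `*`-algebra. -/
structure IsCStarSeminorm {X : Type} (q : Seminorm ℂ (FreeStarAlg X)) : Prop where
  mul_le : ∀ a b, q (a * b) ≤ q a * q b
  star_mul_self : ∀ a, q (star a * a) = q a ^ 2

/-- The C*-seminorms on the free `*`-algebra that vanish on the relations `R` and for which the
generators are contractions. (If the relations force the generators to be isometries or unitaries,
the last condition holds automatically.) -/
def admissibleSeminorms {X : Type} (R : Set (FreeStarAlg X)) :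
    Set (Seminorm ℂ (FreeStarAlg X)) :=
  {q | IsCStarSeminorm q ∧ (∀ x, q (FreeStarAlg.gen x) ≤ 1) ∧ ∀ r ∈ R, q r = 0}

namespace admissibleSeminorms

open FreeStarAlg

variable {X : Type} {R : Set (FreeStarAlg X)}

theorem map_one_le {q : Seminorm ℂ (FreeStarAlg X)} (hq : IsCStarSeminorm q) : q 1 ≤ 1 := by
  have h := hq.star_mul_self 1
  rw [star_one, one_mul] at h
  nlinarith [apply_nonneg q 1]

theorem map_star_le {q : Seminorm ℂ (FreeStarAlg X)} (hq : IsCStarSeminorm q)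
    (a : FreeStarAlg X) : q a ≤ q (star a) := by
  have h := hq.star_mul_self a
  have h' := hq.mul_le (star a) a
  by_contra! hlt
  have : 0 < q a := lt_of_le_of_lt (apply_nonneg q (star a)) hlt
  nlinarith

theorem bdd (R : Set (FreeStarAlg X)) (a : FreeStarAlg X) :
    ∃ C : ℝ, ∀ q ∈ admissibleSeminorms R, q a ≤ C := by
  induction a using FreeStarAlg.induct with
  | h₀ c =>
    refine ⟨‖c‖, fun q hq => ?_⟩
    rw [Algebra.algebraMap_eq_smul_one, map_smul_eq_mul]
    exact mul_le_of_le_one_right (norm_nonneg _) (map_one_le hq.1)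
  | h₁ x => exact ⟨1, fun q hq => hq.2.1 x⟩
  | h₂ x =>
    refine ⟨1, fun q hq => (map_star_le hq.1 _).trans ?_⟩
    rw [star_genStar]
    exact hq.2.1 x
  | hm a b h h' =>
    obtain ⟨C, hC⟩ := h
    obtain ⟨D, hD⟩ := h'
    refine ⟨C * D, fun q hq => (hq.1.mul_le a b).trans ?_⟩
    exact mul_le_mul (hC q hq) (hD q hq) (apply_nonneg _ _)
      ((apply_nonneg q a).trans (hC q hq))
  | ha a b h h' =>
    obtain ⟨C, hC⟩ := h
    obtain ⟨D, hD⟩ := h'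
    exact ⟨C + D, fun q hq => (map_add_le_add q a b).trans (add_le_add (hC q hq) (hD q hq))⟩

theorem zero_mem : (0 : Seminorm ℂ (FreeStarAlg X)) ∈ admissibleSeminorms R :=
  ⟨⟨fun a b => by simp, fun a => by simp⟩, fun x => by simp, fun r _ => by simp⟩

instance : Nonempty (admissibleSeminorms R) := ⟨⟨0, zero_mem⟩⟩

/-- The largest admissible C*-seminorm. -/
def univNorm (R : Set (FreeStarAlg X)) (a : FreeStarAlg X) : ℝ :=
  ⨆ q : admissibleSeminorms R, q.1 a

theorem le_univNorm {q : Seminorm ℂ (FreeStarAlg X)} (hq : q ∈ admissibleSeminorms R)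
    (a : FreeStarAlg X) : q a ≤ univNorm R a :=
  le_ciSup (f := fun q : admissibleSeminorms R => q.1 a)
    (let ⟨C, hC⟩ := bdd R a; ⟨C, by rintro _ ⟨q, rfl⟩; exact hC q.1 q.2⟩) ⟨q, hq⟩

theorem univNorm_le {a : FreeStarAlg X} {C : ℝ} (h : ∀ q ∈ admissibleSeminorms R, q a ≤ C) :
    univNorm R a ≤ C := ciSup_le fun q => h q.1 q.2

theorem univNorm_nonneg (a : FreeStarAlg X) : 0 ≤ univNorm R a :=
  (apply_nonneg (0 : Seminorm ℂ (FreeStarAlg X)) a).trans (le_univNorm zero_mem a)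

theorem univNorm_smul_le (c : ℂ) (a : FreeStarAlg X) :
    univNorm R (c • a) ≤ ‖c‖ * univNorm R a :=
  univNorm_le fun q hq => by
    rw [map_smul_eq_mul]
    exact mul_le_mul_of_nonneg_left (le_univNorm hq a) (norm_nonneg _)

theorem univNorm_star_mul_self (a : FreeStarAlg X) :
    univNorm R a * univNorm R a ≤ univNorm R (star a * a) := by
  have h0 := univNorm_nonneg (R := R) (star a * a)
  have : univNorm R a ≤ √(univNorm R (star a * a)) := univNorm_le fun q hq => by
    refine Real.le_sqrt_of_sq_le ?_
    rw [← hq.1.star_mul_self]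
    exact le_univNorm hq _
  calc _ ≤ √(univNorm R (star a * a)) * √(univNorm R (star a * a)) :=
        mul_self_le_mul_self (univNorm_nonneg a) this
    _ = _ := Real.mul_self_sqrt h0

theorem univNorm_star (a : FreeStarAlg X) : univNorm R (star a) = univNorm R a := by
  have key : ∀ a : FreeStarAlg X, univNorm R a ≤ univNorm R (star a) := fun a =>
    univNorm_le fun q hq => (map_star_le hq.1 a).trans (le_univNorm hq _)
  exact le_antisymm (by simpa using key (star a)) (key a)

/-- The largest admissible C*-seminorm as a ring seminorm. -/
def univRingSeminorm (R : Set (FreeStarAlg X)) : RingSeminorm (FreeStarAlg X) where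
  toFun := univNorm R
  map_zero' := le_antisymm (univNorm_le fun q _ => (map_zero q).le) (univNorm_nonneg 0)
  add_le' a b := univNorm_le fun q hq =>
    (map_add_le_add q a b).trans (add_le_add (le_univNorm hq a) (le_univNorm hq b))
  neg' a := by simp only [univNorm, map_neg_eq_map]
  mul_le' a b := univNorm_le fun q hq => (hq.1.mul_le a b).trans
    (mul_le_mul (le_univNorm hq a) (le_univNorm hq b) (apply_nonneg _ _) (univNorm_nonneg a))

end admissibleSeminorms

open admissibleSeminorms

/-- The free `*`-algebra, equipped with the largest admissible C*-seminorm. -/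
def PreUnivCStar {X : Type} (_R : Set (FreeStarAlg X)) : Type := FreeStarAlg X

section

variable {X : Type} {R : Set (FreeStarAlg X)}

instance : SeminormedRing (PreUnivCStar R) := (univRingSeminorm R).toSeminormedRing

instance : StarRing (PreUnivCStar R) := inferInstanceAs (StarRing (FreeStarAlg X))

instance : NormedAlgebra ℂ (PreUnivCStar R) where
  __ := (inferInstanceAs (Algebra ℂ (FreeStarAlg X)) : Algebra ℂ (PreUnivCStar R))
  norm_smul_le c a := univNorm_smul_le (R := R) c a

instance : StarModule ℂ (PreUnivCStar R) := inferInstanceAs (StarModule ℂ (FreeStarAlg X))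

instance : NormedStarGroup (PreUnivCStar R) := ⟨fun a => (univNorm_star (R := R) a).le⟩

end

/-- The universal unital C*-algebra generated by contractions indexed by `X` subject to the
relations `r = 0`, `r ∈ R`: the Hausdorff completion of the free `*`-algebra for the largest
C*-seminorm compatible with the relations. -/
def UnivCStar {X : Type} (R : Set (FreeStarAlg X)) : Type :=
  UniformSpace.Completion (PreUnivCStar R)

namespace UnivCStar

open UniformSpace

variable {X : Type} {R : Set (FreeStarAlg X)}

instance : NormedRing (UnivCStar R) :=
  inferInstanceAs (NormedRing (Completion (PreUnivCStar R)))

instance : CompleteSpace (UnivCStar R) :=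
  inferInstanceAs (CompleteSpace (Completion (PreUnivCStar R)))

instance : NormedAlgebra ℂ (UnivCStar R) where
  __ := (inferInstanceAs (Algebra ℂ (Completion (PreUnivCStar R))) : Algebra ℂ (UnivCStar R))
  norm_smul_le := norm_smul_le (α := ℂ) (β := Completion (PreUnivCStar R))

/-- The class of a `*`-polynomial in the universal C*-algebra. -/
def mk (R : Set (FreeStarAlg X)) (a : FreeStarAlg X) : UnivCStar R :=
  Completion.coe' (α := PreUnivCStar R) a

theorem denseRange_mk : DenseRange (mk R) :=
  Completion.denseRange_coe (α := PreUnivCStar R)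

theorem norm_mk (a : FreeStarAlg X) : ‖mk R a‖ = univNorm R a :=
  Completion.norm_coe (E := PreUnivCStar R) a

theorem mk_add (a b : FreeStarAlg X) : mk R (a + b) = mk R a + mk R b :=
  Completion.coe_add (α := PreUnivCStar R) a b

theorem mk_mul (a b : FreeStarAlg X) : mk R (a * b) = mk R a * mk R b :=
  Completion.coe_mul (α := PreUnivCStar R) a b

theorem mk_zero : mk R 0 = 0 := rfl

theorem mk_algebraMap (c : ℂ) : mk R (algebraMap ℂ _ c) = algebraMap ℂ (UnivCStar R) c := rfl

instance : Star (UnivCStar R) :=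
  ⟨Completion.map (star : PreUnivCStar R → PreUnivCStar R)⟩

theorem mk_star (a : FreeStarAlg X) : mk R (star a) = star (mk R a) :=
  (Completion.map_coe (f := (star : PreUnivCStar R → PreUnivCStar R))
    (starNormedAddGroupHom (E := PreUnivCStar R)).uniformContinuous a).symm

theorem continuous_star' : Continuous (star : UnivCStar R → UnivCStar R) :=
  Completion.continuous_map

theorem induct {P : UnivCStar R → Prop} (hc : IsClosed {a | P a}) (h : ∀ a, P (mk R a))
    (a : UnivCStar R) : P a := Completion.induction_on (α := PreUnivCStar R) a hc h

instance : StarRing (UnivCStar R) where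
  star_involutive a := by
    induction a using induct with
    | hc => exact isClosed_eq (continuous_star'.comp continuous_star') continuous_id
    | h a => rw [← mk_star, ← mk_star, star_star]
  star_mul a b := by
    induction a using induct with
    | hc =>
      exact isClosed_eq (continuous_star'.comp (continuous_id.mul continuous_const))
        (continuous_const.mul continuous_star')
    | h a =>
      induction b using induct with
      | hc =>
        exact isClosed_eq (continuous_star'.comp (continuous_const.mul continuous_id))
          (continuous_star'.mul continuous_const)
      | h b => rw [← mk_mul, ← mk_star, ← mk_star, ← mk_star, ← mk_mul, star_mul]
  star_add a b := by
    induction a using induct with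
    | hc =>
      exact isClosed_eq (continuous_star'.comp (continuous_id.add continuous_const))
        (continuous_star'.add continuous_const)
    | h a =>
      induction b using induct with
      | hc =>
        exact isClosed_eq (continuous_star'.comp (continuous_const.add continuous_id))
          (continuous_const.add continuous_star')
      | h b => rw [← mk_add, ← mk_star, ← mk_star, ← mk_star, ← mk_add, star_add]

instance : StarModule ℂ (UnivCStar R) where
  star_smul c a := by
    induction a using induct with
    | hc =>
      exact isClosed_eq (continuous_star'.comp (continuous_id.const_smul c))
        (continuous_star'.const_smul (star c))
    | h a =>
      rw [Algebra.smul_def, Algebra.smul_def, ← mk_algebraMap, ← mk_algebraMap, ← mk_mul,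
        ← mk_star, ← mk_star, ← mk_mul, star_mul, FreeStarAlg.star_algebraMap', Algebra.commutes]

instance : CStarRing (UnivCStar R) where
  norm_mul_self_le a := by
    induction a using induct with
    | hc =>
      exact isClosed_le (continuous_norm.mul continuous_norm)
        (continuous_norm.comp (continuous_star'.mul continuous_id))
    | h a => rw [← mk_star, ← mk_mul, norm_mk, norm_mk]; exact univNorm_star_mul_self a

instance : CStarAlgebra (UnivCStar R) where

/-- The quotient map from `*`-polynomials. -/
def mkHom (R : Set (FreeStarAlg X)) : FreeStarAlg X →⋆ₐ[ℂ] UnivCStar R where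
  toFun := mk R
  map_one' := rfl
  map_mul' := mk_mul
  map_zero' := mk_zero
  map_add' := mk_add
  commutes' := mk_algebraMap
  map_star' := mk_star

/-- The canonical generators. -/
def gen (R : Set (FreeStarAlg X)) (x : X) : UnivCStar R := mkHom R (FreeStarAlg.gen x)

theorem mkHom_eq_zero {r : FreeStarAlg X} (hr : r ∈ R) : mkHom R r = 0 := by
  rw [← norm_eq_zero]
  exact (norm_mk (R := R) r).trans
    (le_antisymm (univNorm_le fun q hq => (hq.2.2 r hr).le) (univNorm_nonneg r))

section lift

variable {B : Type*} [CStarAlgebra B]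

theorem norm_eval_le (b : X → B) (hb : ∀ x, ‖b x‖ ≤ 1)
    (hR : ∀ r ∈ R, FreeStarAlg.eval b r = 0) (a : FreeStarAlg X) :
    ‖FreeStarAlg.eval b a‖ ≤ univNorm R a := by
  let q : Seminorm ℂ (FreeStarAlg X) :=
    (normSeminorm ℂ B).comp (FreeStarAlg.eval b).toAlgHom.toLinearMap
  have hq : ∀ a, q a = ‖FreeStarAlg.eval b a‖ := fun _ => rfl
  have : q ∈ admissibleSeminorms R := by
    refine ⟨⟨fun a b => ?_, fun a => ?_⟩, fun x => ?_, fun r hr => ?_⟩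
    · simp only [hq, map_mul]; exact norm_mul_le _ _
    · simp only [hq, map_mul, map_star, CStarRing.norm_star_mul_self, sq]
    · simp only [hq, FreeStarAlg.eval_gen]; exact hb x
    · rw [hq, hR r hr, norm_zero]
  exact le_univNorm this a

/-- The evaluation map as a continuous map on the free `*`-algebra with its seminorm. -/
theorem uniformContinuous_eval (b : X → B) (hb : ∀ x, ‖b x‖ ≤ 1)
    (hR : ∀ r ∈ R, FreeStarAlg.eval b r = 0) :
    UniformContinuous (fun a : PreUnivCStar R => FreeStarAlg.eval b (a : FreeStarAlg X)) := by
  let f : PreUnivCStar R →+ B := (FreeStarAlg.eval b : FreeStarAlg X →⋆ₐ[ℂ] B).toAlgHom.toAddMonoidHom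
  refine (AddMonoidHomClass.lipschitz_of_bound f 1 fun a => ?_).uniformContinuous
  rw [one_mul]
  exact norm_eval_le b hb hR a

/-- The continuous extension of the evaluation map. -/
def liftFun (R : Set (FreeStarAlg X)) (b : X → B) : UnivCStar R → B :=
  Completion.extension (fun a : PreUnivCStar R => FreeStarAlg.eval b (a : FreeStarAlg X))

theorem continuous_liftFun (b : X → B) : Continuous (liftFun R b) :=
  Completion.continuous_extension

theorem liftFun_mk (b : X → B) (hb : ∀ x, ‖b x‖ ≤ 1)
    (hR : ∀ r ∈ R, FreeStarAlg.eval b r = 0) (a : FreeStarAlg X) :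
    liftFun R b (mk R a) = FreeStarAlg.eval b a :=
  Completion.extension_coe (uniformContinuous_eval b hb hR) _

/-- The universal property: contractions satisfying the relations determine a `*`-homomorphism. -/
def lift (b : X → B) (hb : ∀ x, ‖b x‖ ≤ 1) (hR : ∀ r ∈ R, FreeStarAlg.eval b r = 0) :
    UnivCStar R →⋆ₐ[ℂ] B where
  toFun := liftFun R b
  map_one' := (liftFun_mk b hb hR 1).trans (map_one _)
  map_zero' := (liftFun_mk b hb hR 0).trans (map_zero _)
  map_mul' a a' := by
    have hc := continuous_liftFun (R := R) b
    induction a using induct with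
    | hc =>
      exact isClosed_eq (hc.comp (continuous_id.mul continuous_const)) (hc.mul continuous_const)
    | h a =>
      induction a' using induct with
      | hc =>
        exact isClosed_eq (hc.comp (continuous_const.mul continuous_id)) (continuous_const.mul hc)
      | h a' => simp only [← mk_mul, liftFun_mk b hb hR, map_mul]
  map_add' a a' := by
    have hc := continuous_liftFun (R := R) b
    induction a using induct with
    | hc =>
      exact isClosed_eq (hc.comp (continuous_id.add continuous_const)) (hc.add continuous_const)
    | h a =>
      induction a' using induct with
      | hc =>
        exact isClosed_eq (hc.comp (continuous_const.add continuous_id)) (continuous_const.add hc)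
      | h a' => simp only [← mk_add, liftFun_mk b hb hR, map_add]
  commutes' c := (liftFun_mk b hb hR _).trans ((FreeStarAlg.eval b).toAlgHom.commutes c)
  map_star' a := by
    have hc := continuous_liftFun (R := R) b
    change liftFun R b (star a) = star (liftFun R b a)
    induction a using induct with
    | hc => exact isClosed_eq (hc.comp continuous_star') (continuous_star.comp hc)
    | h a => simp only [← mk_star, liftFun_mk b hb hR, map_star]

@[simp] theorem lift_gen (b : X → B) (hb : ∀ x, ‖b x‖ ≤ 1)
    (hR : ∀ r ∈ R, FreeStarAlg.eval b r = 0) (x : X) : lift b hb hR (gen R x) = b x :=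
  (liftFun_mk b hb hR _).trans (FreeStarAlg.eval_gen b x)

end lift

/-- A closed `*`-subalgebra containing the generators is everything. -/
theorem induct_gen {P : UnivCStar R → Prop} (hc : IsClosed {a | P a})
    (h₀ : ∀ c : ℂ, P (algebraMap ℂ _ c)) (h₁ : ∀ x, P (gen R x)) (h₂ : ∀ x, P (star (gen R x)))
    (hm : ∀ a b, P a → P b → P (a * b)) (ha : ∀ a b, P a → P b → P (a + b))
    (a : UnivCStar R) : P a := by
  induction a using induct with
  | hc => exact hc
  | h a =>
    induction a using FreeStarAlg.induct with
    | h₀ c => exact h₀ c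
    | h₁ x => exact h₁ x
    | h₂ x => rw [← FreeStarAlg.star_gen, mk_star]; exact h₂ x
    | hm a b h h' => rw [mk_mul]; exact hm _ _ h h'
    | ha a b h h' => rw [mk_add]; exact ha _ _ h h'

end UnivCStar

/-! ### The Cuntz algebra and the 2-adic ring C*-algebra -/

/-- The two generators of the Cuntz algebra. -/
inductive CuntzGen | s1 | s2

/-- The two generators of the 2-adic ring C*-algebra. -/
inductive TwoAdicGen | u | s

/-- `x₁* x₁ = 1`, `x₂* x₂ = 1`, `x₁ x₁* + x₂ x₂* = 1`. -/
def cuntzRelations : Set (FreeStarAlg CuntzGen) :=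
  let x₁ := FreeStarAlg.gen CuntzGen.s1
  let x₂ := FreeStarAlg.gen CuntzGen.s2
  {star x₁ * x₁ - 1, star x₂ * x₂ - 1, x₁ * star x₁ + x₂ * star x₂ - 1}

/-- `u* u = 1`, `u u* = 1`, `s* s = 1`, `s u = u² s`, `s s* + u s s* u* = 1`. -/
def twoAdicRelations : Set (FreeStarAlg TwoAdicGen) :=
  let u := FreeStarAlg.gen TwoAdicGen.u
  let s := FreeStarAlg.gen TwoAdicGen.s
  {star u * u - 1, u * star u - 1, star s * s - 1, s * u - u ^ 2 * s,
    s * star s + u * s * star s * star u - 1}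

/-- The Cuntz algebra `O₂`: the universal C*-algebra generated by two isometries whose range
projections sum to `1`. -/
abbrev CuntzO2 : Type := UnivCStar cuntzRelations

/-- The 2-adic ring C*-algebra `Q₂`: the universal C*-algebra generated by a unitary `U` and an
isometry `S₂` with `S₂ U = U² S₂` and `S₂ S₂* + U S₂ S₂* U* = 1`. -/
abbrev TwoAdicQ2 : Type := UnivCStar twoAdicRelations

theorem norm_le_one_of_isometry {B : Type*} [CStarAlgebra B] {a : B} (h : star a * a = 1) :
    ‖a‖ ≤ 1 := by
  have h1 : ‖a‖ * ‖a‖ = ‖(1 : B)‖ := by rw [← CStarRing.norm_star_mul_self, h]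
  have h2 : ‖(1 : B)‖ * ‖(1 : B)‖ = ‖(1 : B)‖ := by
    rw [← CStarRing.norm_star_mul_self, star_one, one_mul]
  have h3 : ‖(1 : B)‖ ≤ 1 := by nlinarith [norm_nonneg (1 : B)]
  nlinarith [norm_nonneg a]

namespace CuntzO2

/-- The generating isometries. -/
def S (i : CuntzGen) : CuntzO2 := UnivCStar.gen cuntzRelations i

/-- The universal property of `O₂`. -/
def lift {B : Type*} [CStarAlgebra B] (x : CuntzGen → B) (h : ∀ i, star (x i) * x i = 1)
    (hsum : x .s1 * star (x .s1) + x .s2 * star (x .s2) = 1) : CuntzO2 →⋆ₐ[ℂ] B :=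
  UnivCStar.lift x (fun i => norm_le_one_of_isometry (h i)) (by
    intro r hr
    simp only [cuntzRelations, Set.mem_insert_iff, Set.mem_singleton_iff] at hr
    rcases hr with rfl | rfl | rfl <;>
      simp only [map_sub, map_add, map_mul, map_star, map_one, FreeStarAlg.eval_gen, h, hsum,
        sub_self])

@[simp] theorem lift_S {B : Type*} [CStarAlgebra B] (x : CuntzGen → B)
    (h : ∀ i, star (x i) * x i = 1)
    (hsum : x .s1 * star (x .s1) + x .s2 * star (x .s2) = 1) (i : CuntzGen) :
    lift x h hsum (S i) = x i := UnivCStar.lift_gen _ _ _ i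

end CuntzO2

namespace TwoAdicQ2

/-- The generating unitary. -/
def U : TwoAdicQ2 := UnivCStar.gen twoAdicRelations .u

/-- The generating isometry. -/
def S₂ : TwoAdicQ2 := UnivCStar.gen twoAdicRelations .s

theorem relation_eq {a b : FreeStarAlg TwoAdicGen} (h : a - b ∈ twoAdicRelations) :
    UnivCStar.mkHom twoAdicRelations a = UnivCStar.mkHom twoAdicRelations b := by
  rw [← sub_eq_zero, ← map_sub]
  exact UnivCStar.mkHom_eq_zero h

theorem star_U_mul_U : star U * U = 1 := by
  simpa only [U, UnivCStar.gen, map_mul, map_star, map_one] using relation_eq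
    (a := star (FreeStarAlg.gen TwoAdicGen.u) * FreeStarAlg.gen TwoAdicGen.u) (b := 1)
    (by simp [twoAdicRelations])

theorem star_S₂_mul_S₂ : star S₂ * S₂ = 1 := by
  simpa only [S₂, UnivCStar.gen, map_mul, map_star, map_one] using relation_eq
    (a := star (FreeStarAlg.gen TwoAdicGen.s) * FreeStarAlg.gen TwoAdicGen.s) (b := 1)
    (by simp [twoAdicRelations])

theorem range_sum : S₂ * star S₂ + U * S₂ * star S₂ * star U = 1 := by
  simpa only [U, S₂, UnivCStar.gen, map_add, map_mul, map_star, map_one] using relation_eq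
    (a := FreeStarAlg.gen TwoAdicGen.s * star (FreeStarAlg.gen TwoAdicGen.s) +
      FreeStarAlg.gen TwoAdicGen.u * FreeStarAlg.gen TwoAdicGen.s *
        star (FreeStarAlg.gen TwoAdicGen.s) * star (FreeStarAlg.gen TwoAdicGen.u)) (b := 1)
    (by simp [twoAdicRelations])

/-- The universal property of `Q₂`. -/
def lift {B : Type*} [CStarAlgebra B] (u s : B) (hu : star u * u = 1) (hu' : u * star u = 1)
    (hs : star s * s = 1) (hsu : s * u = u ^ 2 * s)
    (hsum : s * star s + u * s * star s * star u = 1) : TwoAdicQ2 →⋆ₐ[ℂ] B :=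
  UnivCStar.lift (TwoAdicGen.rec u s)
    (fun i => by
      cases i
      · exact norm_le_one_of_isometry hu
      · exact norm_le_one_of_isometry hs)
    (by
      intro r hr
      simp only [twoAdicRelations, Set.mem_insert_iff, Set.mem_singleton_iff] at hr
      rcases hr with rfl | rfl | rfl | rfl | rfl <;>
        simp only [map_sub, map_add, map_mul, map_star, map_one, map_pow, FreeStarAlg.eval_gen,
          hu, hu', hs, hsu, hsum, sub_self])

section

variable {B : Type*} [CStarAlgebra B] (u s : B) (hu : star u * u = 1) (hu' : u * star u = 1)
    (hs : star s * s = 1) (hsu : s * u = u ^ 2 * s)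
    (hsum : s * star s + u * s * star s * star u = 1)

@[simp] theorem lift_U : lift u s hu hu' hs hsu hsum U = u := UnivCStar.lift_gen _ _ _ TwoAdicGen.u

@[simp] theorem lift_S₂ : lift u s hu hu' hs hsu hsum S₂ = s :=
  UnivCStar.lift_gen _ _ _ TwoAdicGen.s

end

end TwoAdicQ2

/-- The inclusion `O₂ ⊂ Q₂`, `S₁ ↦ U S₂`, `S₂ ↦ S₂`. -/
def cuntzInclusion : CuntzO2 →⋆ₐ[ℂ] TwoAdicQ2 :=
  CuntzO2.lift (CuntzGen.rec (TwoAdicQ2.U * TwoAdicQ2.S₂) TwoAdicQ2.S₂)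
    (fun i => by
      cases i
      · change star (TwoAdicQ2.U * TwoAdicQ2.S₂) * (TwoAdicQ2.U * TwoAdicQ2.S₂) = 1
        rw [star_mul, mul_assoc, ← mul_assoc (star TwoAdicQ2.U), TwoAdicQ2.star_U_mul_U, one_mul,
          TwoAdicQ2.star_S₂_mul_S₂]
      · exact TwoAdicQ2.star_S₂_mul_S₂)
    (by
      change TwoAdicQ2.U * TwoAdicQ2.S₂ * star (TwoAdicQ2.U * TwoAdicQ2.S₂) +
        TwoAdicQ2.S₂ * star TwoAdicQ2.S₂ = 1
      rw [star_mul, ← mul_assoc, add_comm]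
      exact TwoAdicQ2.range_sum)

theorem cuntzInclusion_s1 :
    cuntzInclusion (CuntzO2.S .s1) = TwoAdicQ2.U * TwoAdicQ2.S₂ := CuntzO2.lift_S _ _ _ _

theorem cuntzInclusion_s2 : cuntzInclusion (CuntzO2.S .s2) = TwoAdicQ2.S₂ := CuntzO2.lift_S _ _ _ _

/-! ### The canonical representation -/

/-- The Hilbert space `ℓ²(ℤ)`. -/
abbrev L2Z : Type := lp (fun _ : ℤ => ℂ) 2

/-- The canonical orthonormal basis of `ℓ²(ℤ)`. -/
def stdBasis (k : ℤ) : L2Z := lp.single 2 k 1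

theorem inner_stdBasis (j k : ℤ) : ⟪stdBasis j, stdBasis k⟫_ℂ = if j = k then 1 else 0 := by
  rw [stdBasis, stdBasis, lp.inner_single_left, lp.single_apply, Pi.single_apply]
  split_ifs <;> simp

theorem orthonormal_comp {f : ℤ → ℤ} (hf : Function.Injective f) :
    Orthonormal ℂ (fun k => stdBasis (f k)) := by
  classical
  rw [orthonormal_iff_ite]
  intro i j
  rw [inner_stdBasis]
  simp only [hf.eq_iff]

/-- The isometry `e_k ↦ e_{f k}` of `ℓ²(ℤ)` attached to an injection `f` of `ℤ`. -/
def basisIsometry (f : ℤ → ℤ) (hf : Function.Injective f) : L2Z →L[ℂ] L2Z :=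
  (orthonormal_comp hf).orthogonalFamily.linearIsometry.toContinuousLinearMap

@[simp] theorem basisIsometry_apply (f : ℤ → ℤ) (hf : Function.Injective f) (k : ℤ) :
    basisIsometry f hf (stdBasis k) = stdBasis (f k) := by
  have := (orthonormal_comp hf).orthogonalFamily.linearIsometry_apply_single (i := k) (1 : ℂ)
  exact this.trans (by simp)

/-- Vectors of `ℓ²(ℤ)` are determined by their inner products with the basis. -/
theorem ext_inner {x y : L2Z} (h : ∀ k, ⟪stdBasis k, x⟫_ℂ = ⟪stdBasis k, y⟫_ℂ) : x = y := by
  ext k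
  simpa [stdBasis, lp.inner_single_left] using h k

/-- Operators on `ℓ²(ℤ)` are determined by their values on the basis. -/
theorem ext_basis {S T : L2Z →L[ℂ] L2Z} (h : ∀ k, S (stdBasis k) = T (stdBasis k)) : S = T := by
  have h' : ContinuousLinearMap.adjoint S = ContinuousLinearMap.adjoint T := by
    ext1 x
    refine ext_inner fun k => ?_
    rw [ContinuousLinearMap.adjoint_inner_right, ContinuousLinearMap.adjoint_inner_right, h]
  simpa using congrArg ContinuousLinearMap.adjoint h'

theorem star_basisIsometry_apply (f : ℤ → ℤ) (hf : Function.Injective f) (k : ℤ) :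
    star (basisIsometry f hf) (stdBasis (f k)) = stdBasis k := by
  refine ext_inner fun j => ?_
  rw [ContinuousLinearMap.star_eq_adjoint, ContinuousLinearMap.adjoint_inner_right,
    basisIsometry_apply, inner_stdBasis, inner_stdBasis]
  simp only [hf.eq_iff]

theorem star_basisIsometry_apply_zero (f : ℤ → ℤ) (hf : Function.Injective f) (k : ℤ)
    (hk : ∀ j, f j ≠ k) : star (basisIsometry f hf) (stdBasis k) = 0 := by
  refine ext_inner fun j => ?_
  rw [ContinuousLinearMap.star_eq_adjoint, ContinuousLinearMap.adjoint_inner_right,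
    basisIsometry_apply, inner_stdBasis, if_neg (hk j), inner_zero_right]

/-- The bilateral shift `e_k ↦ e_{k+1}`. -/
def shiftZ : L2Z →L[ℂ] L2Z := basisIsometry (fun k => k + 1) (add_left_injective 1)

/-- The isometry `e_k ↦ e_{2k}`. -/
def doubleZ : L2Z →L[ℂ] L2Z :=
  basisIsometry (fun k => 2 * k) (mul_right_injective₀ two_ne_zero)

theorem star_basisIsometry_mul (f : ℤ → ℤ) (hf : Function.Injective f) :
    star (basisIsometry f hf) * basisIsometry f hf = 1 :=
  ext_basis fun k => by
    rw [mul_apply_eq_comp, basisIsometry_apply, star_basisIsometry_apply]; rfl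

theorem shiftZ_apply (k : ℤ) : shiftZ (stdBasis k) = stdBasis (k + 1) := basisIsometry_apply _ _ k

theorem doubleZ_apply (k : ℤ) : doubleZ (stdBasis k) = stdBasis (2 * k) := basisIsometry_apply _ _ k

theorem star_shiftZ_apply (k : ℤ) : star shiftZ (stdBasis k) = stdBasis (k - 1) := by
  have := star_basisIsometry_apply (fun k => k + 1) (add_left_injective (1 : ℤ)) (k - 1)
  simpa using! this

theorem star_doubleZ_even (k : ℤ) : star doubleZ (stdBasis (2 * k)) = stdBasis k :=
  star_basisIsometry_apply _ _ k

theorem star_doubleZ_odd (k : ℤ) : star doubleZ (stdBasis (2 * k + 1)) = 0 :=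
  star_basisIsometry_apply_zero _ _ _ fun j => by change 2 * j ≠ _; omega

/-- The canonical representation `ρ_c` of `Q₂` on `ℓ²(ℤ)`: `U e_k = e_{k+1}`, `S₂ e_k = e_{2k}`. -/
def canonicalRep : TwoAdicQ2 →⋆ₐ[ℂ] (L2Z →L[ℂ] L2Z) :=
  TwoAdicQ2.lift shiftZ doubleZ (star_basisIsometry_mul _ _)
    (ext_basis fun k => by
      rw [mul_apply_eq_comp, star_shiftZ_apply, shiftZ_apply, sub_add_cancel]; rfl)
    (star_basisIsometry_mul _ _)
    (ext_basis fun k => by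
      simp only [sq, mul_apply_eq_comp, shiftZ_apply, doubleZ_apply]
      congr 1; ring)
    (ext_basis fun k => by
      simp only [add_apply, mul_apply_eq_comp, star_shiftZ_apply]
      obtain ⟨j, rfl | rfl⟩ := Int.even_or_odd' k
      · rw [star_doubleZ_even, doubleZ_apply,
          show 2 * j - 1 = 2 * (j - 1) + 1 by ring, star_doubleZ_odd]
        simp
      · rw [star_doubleZ_odd, add_sub_cancel_right, star_doubleZ_even, doubleZ_apply, shiftZ_apply]
        simp)

/-- The restriction `π_c` of the canonical representation to `O₂`. -/
def cuntzCanonicalRep : CuntzO2 →⋆ₐ[ℂ] (L2Z →L[ℂ] L2Z) := canonicalRep.comp cuntzInclusion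

theorem canonicalRep_U : canonicalRep TwoAdicQ2.U = shiftZ := TwoAdicQ2.lift_U _ _ _ _ _ _ _

theorem canonicalRep_S₂ : canonicalRep TwoAdicQ2.S₂ = doubleZ := TwoAdicQ2.lift_S₂ _ _ _ _ _ _ _

theorem cuntzCanonicalRep_s1 : cuntzCanonicalRep (CuntzO2.S .s1) = shiftZ * doubleZ := by
  rw [cuntzCanonicalRep, StarAlgHom.comp_apply, cuntzInclusion_s1, map_mul, canonicalRep_U,
    canonicalRep_S₂]

theorem cuntzCanonicalRep_s2 : cuntzCanonicalRep (CuntzO2.S .s2) = doubleZ := by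
  rw [cuntzCanonicalRep, StarAlgHom.comp_apply, cuntzInclusion_s2, canonicalRep_S₂]

/-! ### Subrepresentations and the representations `π₊`, `π₋` -/

/-- The restriction of a representation to a closed invariant subspace. -/
def subrep {A : Type*} [CStarAlgebra A] {H : Type*} [NormedAddCommGroup H]
    [InnerProductSpace ℂ H] [CompleteSpace H] (π : A →⋆ₐ[ℂ] (H →L[ℂ] H)) (K : Submodule ℂ H)
    [CompleteSpace K] (hK : ∀ a, ∀ v ∈ K, π a v ∈ K) : A →⋆ₐ[ℂ] (K →L[ℂ] K) where
  toFun a := ((π a).comp K.subtypeL).codRestrict K (fun v => hK a v v.2)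
  map_one' := by ext v; simp
  map_mul' a b := by
    ext v; exact congrArg (fun T : H →L[ℂ] H => T v) (map_mul π a b)
  map_zero' := by ext v; simp
  map_add' a b := by
    ext v; exact congrArg (fun T : H →L[ℂ] H => T v) (map_add π a b)
  commutes' c := by ext v; simp [Algebra.algebraMap_eq_smul_one]
  map_star' a := by
    rw [ContinuousLinearMap.star_eq_adjoint, ContinuousLinearMap.eq_adjoint_iff]
    intro v w
    change ⟪π (star a) v, (w : H)⟫_ℂ = ⟪(v : H), π a w⟫_ℂ
    rw [map_star, ContinuousLinearMap.star_eq_adjoint, ContinuousLinearMap.adjoint_inner_left]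

/-- The closed linear span of the basis vectors `e_k`, `k ∈ s`. -/
abbrev basisSpan (s : Set ℤ) : Submodule ℂ L2Z :=
  (Submodule.span ℂ (stdBasis '' s)).topologicalClosure

theorem basisSpan_invariant {s : Set ℤ} {T : L2Z →L[ℂ] L2Z}
    (h : ∀ k ∈ s, T (stdBasis k) ∈ basisSpan s) : ∀ v ∈ basisSpan s, T v ∈ basisSpan s := by
  have h1 : Submodule.span ℂ (stdBasis '' s) ≤ (basisSpan s).comap T.toLinearMap :=
    Submodule.span_le.2 (by rintro _ ⟨k, hk, rfl⟩; exact h k hk)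
  exact Submodule.topologicalClosure_minimal _ h1
    ((Submodule.isClosed_topologicalClosure _).preimage T.continuous)

theorem stdBasis_mem {s : Set ℤ} {k : ℤ} (hk : k ∈ s) : stdBasis k ∈ basisSpan s :=
  Submodule.le_topologicalClosure _ (Submodule.subset_span ⟨k, hk, rfl⟩)

/-- If `k ∈ s ↔ 2k ∈ s ↔ 2k+1 ∈ s`, the closed span of `{e_k : k ∈ s}` is invariant under `O₂`. -/
theorem cuntz_invariant {s : Set ℤ} (h0 : ∀ k, 2 * k ∈ s ↔ k ∈ s) (h1 : ∀ k, 2 * k + 1 ∈ s ↔ k ∈ s)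
    (a : CuntzO2) : ∀ v ∈ basisSpan s, cuntzCanonicalRep a v ∈ basisSpan s := by
  have hcont : Continuous cuntzCanonicalRep :=
    AddMonoidHomClass.continuous_of_bound cuntzCanonicalRep 1 fun a => by
      rw [one_mul]; exact NonUnitalStarAlgHom.norm_apply_le cuntzCanonicalRep a
  induction a using UnivCStar.induct_gen with
  | hc =>
    simp only [Set.ofPred_forall]
    exact isClosed_iInter fun v => isClosed_iInter fun _ =>
      (Submodule.isClosed_topologicalClosure _).preimage
        ((ContinuousLinearMap.apply ℂ L2Z v).continuous.comp hcont)
  | h₀ c =>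
    intro v hv
    have : cuntzCanonicalRep (algebraMap ℂ _ c) v = c • v := by
      rw [AlgHomClass.commutes, Algebra.algebraMap_eq_smul_one]; rfl
    rw [this]
    exact Submodule.smul_mem _ c hv
  | h₁ x =>
    refine basisSpan_invariant fun k hk => ?_
    cases x
    · erw [cuntzCanonicalRep_s1]
      rw [mul_apply_eq_comp, doubleZ_apply, shiftZ_apply]
      exact stdBasis_mem ((h1 k).2 hk)
    · erw [cuntzCanonicalRep_s2]
      rw [doubleZ_apply]
      exact stdBasis_mem ((h0 k).2 hk)
  | h₂ x =>
    refine basisSpan_invariant fun k hk => ?_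
    rw [map_star]
    cases x
    · erw [cuntzCanonicalRep_s1]
      rw [star_mul, mul_apply_eq_comp, star_shiftZ_apply]
      obtain ⟨j, rfl | rfl⟩ := Int.even_or_odd' k
      · rw [show 2 * j - 1 = 2 * (j - 1) + 1 by ring, star_doubleZ_odd]
        exact Submodule.zero_mem _
      · rw [add_sub_cancel_right, star_doubleZ_even]
        exact stdBasis_mem ((h1 j).1 hk)
    · erw [cuntzCanonicalRep_s2]
      obtain ⟨j, rfl | rfl⟩ := Int.even_or_odd' k
      · rw [star_doubleZ_even]
        exact stdBasis_mem ((h0 j).1 hk)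
      · rw [star_doubleZ_odd]
        exact Submodule.zero_mem _
  | hm a b ha hb =>
    intro v hv
    rw [map_mul, mul_apply_eq_comp]
    exact ha _ (hb v hv)
  | ha a b ha hb =>
    intro v hv
    rw [map_add, add_apply]
    exact Submodule.add_mem _ (ha v hv) (hb v hv)

/-- `H₊`, the closed span of `{e_k : k ≥ 0}`. -/
abbrev HPlus : Submodule ℂ L2Z := basisSpan {k | 0 ≤ k}

/-- `H₋`, the closed span of `{e_k : k < 0}`. -/
abbrev HMinus : Submodule ℂ L2Z := basisSpan {k | k < 0}

/-- The representation `π₊` of `O₂` on `H₊`. -/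
def piPlus : CuntzO2 →⋆ₐ[ℂ] (HPlus →L[ℂ] HPlus) :=
  subrep cuntzCanonicalRep HPlus (cuntz_invariant
    (fun k => by simp only [Set.mem_ofPred_eq]; omega)
    (fun k => by simp only [Set.mem_ofPred_eq]; omega))

/-- The representation `π₋` of `O₂` on `H₋`. -/
def piMinus : CuntzO2 →⋆ₐ[ℂ] (HMinus →L[ℂ] HMinus) :=
  subrep cuntzCanonicalRep HMinus (cuntz_invariant
    (fun k => by simp only [Set.mem_ofPred_eq]; omega)
    (fun k => by simp only [Set.mem_ofPred_eq]; omega))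

/-! ### Permutative representations -/

/-- The representation `π` of `O₂` is of type `P(i)`, `i ∈ {1, 2}`: it is permutative (for some
orthonormal basis `(e_n)` and some branching function system `(σ₁, σ₂)` on `ℕ`, one has
`π(S_j) e_n = e_{σ_j(n)}`), and it has a cyclic basis vector fixed by `π(S_i)`. -/
def IsOfTypeP {H : Type*} [NormedAddCommGroup H] [InnerProductSpace ℂ H] [CompleteSpace H]
    (i : CuntzGen) (π : CuntzO2 →⋆ₐ[ℂ] (H →L[ℂ] H)) : Prop :=
  ∃ (e : HilbertBasis ℕ ℂ H) (σ : CuntzGen → ℕ → ℕ),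
    (∀ j, Function.Injective (σ j)) ∧
    IsCompl (Set.range (σ .s1)) (Set.range (σ .s2)) ∧
    (∀ j n, π (CuntzO2.S j) (e n) = e (σ j n)) ∧
    ∃ n, π (CuntzO2.S i) (e n) = e n ∧ Dense (Set.range fun a : CuntzO2 => π a (e n))

/-! ### States -/

/-- The states of a unital C*-algebra: positive linear functionals with value `1` at `1`. -/
def states (A : Type*) [CStarAlgebra A] : Set (A →ₗ[ℂ] ℂ) :=
  {ω | (∀ a, 0 ≤ ω (star a * a)) ∧ ω 1 = 1}

/-- The pure states: the extreme points of the convex set of states. -/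
def pureStates (A : Type*) [CStarAlgebra A] : Set (A →ₗ[ℂ] ℂ) :=
  (states A).extremePoints ℝ

/-- The functional `a ↦ (π(a) x, x)` (linear in its first entry, so `⟪x, π a x⟫` in Mathlib's
convention, linear in the second entry); it is a state if `‖x‖ = 1`. -/
def vectorState {A : Type*} [CStarAlgebra A] {H : Type*} [NormedAddCommGroup H]
    [InnerProductSpace ℂ H] [CompleteSpace H] (π : A →⋆ₐ[ℂ] (H →L[ℂ] H)) (x : H) : A →ₗ[ℂ] ℂ where
  toFun a := ⟪x, π a x⟫_ℂ
  map_add' a b := by simp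
  map_smul' c a := by simp

/-- The unique extension property of a pure state `ω` of `O₂` with respect to `O₂ ⊂ Q₂`: exactly
one pure state of `Q₂` restricts to `ω`. -/
def HasUniquePureExtension (ω : CuntzO2 →ₗ[ℂ] ℂ) : Prop :=
  ∃! Ω : TwoAdicQ2 →ₗ[ℂ] ℂ, Ω ∈ pureStates TwoAdicQ2 ∧ ∀ T : CuntzO2, Ω (cuntzInclusion T) = ω T

end

/-! Let `e` be a cyclic unit vector with `π(S_i) e = e`. The vectors `π(S_α) e`, over words `α`,
span a dense subspace, and the Cuntz relations together with the fixed-point equation determine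
their Gram matrix completely: equal first letters cancel, distinct first letters give orthogonal
vectors, and an exhausted word can always be prolonged by the letter `i`. In any other
representation a vector `f` fixed by `S_i` yields the same matrix times `‖f‖²`
(`CuntzO2.inner_word_word`). Hence every bounded intertwiner `R` out of `π` multiplies inner
products by `‖R e‖²` (`CuntzO2.inner_intertwiner`), which plays the part of Schur's lemma.

Irreducibility and purity follow. The projection onto a nonzero closed invariant subspace is an
intertwiner that is isometric on some nonzero vector, hence isometric everywhere, so the subspace is
the whole space. A state `φ` with a positive multiple below `ω_x` has a GNS vector that is the image
of `x` under an intertwiner, so `φ` is a multiple of `ω_x`, hence equal to it.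

For the extension property, let `V₀` embed `π` isometrically in the canonical representation,
carrying `e` to the basis vector fixed by `S_i` (`e_{-1}` or `e_0`). The vector state of `V₀ x` is
one extension. Given any state `Ω` extending `ω_x`, with GNS representation `ρ` and vector `ξ`,
there is an isometric intertwiner `V` over `O₂` with `V x = ξ`, and `f = V e` is a unit vector fixed
by `S_i`. The relations of `Q₂` force the vectors `U^k f` to be orthonormal
(`IsTwoAdicPair.inner_pow_eq_zero`), so `f` generates a copy of `ℓ²(ℤ)` through an isometry `W`
intertwining all of `Q₂`. Then `V = W V₀`, and `Ω` is the vector state of `V₀ x`. The extension is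
thus unique even among all states, which also gives its purity. -/

/-! ### Operators determined by their values on a total family -/

section Total

variable {H : Type*} [NormedAddCommGroup H] [InnerProductSpace ℂ H] [CompleteSpace H]
  {K : Type*} [NormedAddCommGroup K] [InnerProductSpace ℂ K] [CompleteSpace K]

/-- A bounded operator that multiplies the Gram matrix of a total family by `c` multiplies all
inner products by `c`. -/
theorem inner_map_of_gram {κ : Type*} {v : κ → H}
    (hv : Dense (Submodule.span ℂ (Set.range v) : Set H)) (R : H →L[ℂ] K) (c : ℂ)
    (h : ∀ j k, ⟪R (v j), R (v k)⟫_ℂ = c * ⟪v j, v k⟫_ℂ) (x y : H) :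
    ⟪R x, R y⟫_ℂ = c * ⟪x, y⟫_ℂ := by
  -- The claim amounts to `R* R = c`. Density is used twice, for the vector and for the test vector;
  -- conjugation enters because the test vector sits in the second slot of the inner product.
  have key : ContinuousLinearMap.adjoint R ∘L R = c • ContinuousLinearMap.id ℂ H := by
    refine ContinuousLinearMap.ext_on hv ?_
    rintro _ ⟨k, rfl⟩
    have : innerSL ℂ ((ContinuousLinearMap.adjoint R ∘L R) (v k)) =
        innerSL ℂ ((c • ContinuousLinearMap.id ℂ H) (v k)) := by
      refine ContinuousLinearMap.ext_on hv ?_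
      rintro _ ⟨j, rfl⟩
      have := congrArg (starRingEnd ℂ) (h j k)
      simp only [map_mul, inner_conj_symm] at this
      simp [ContinuousLinearMap.adjoint_inner_left, this]
    refine ext_inner_right ℂ fun z => ?_
    exact congrArg (fun f : H →L[ℂ] ℂ => f z) this
  have := congrArg (fun T : H →L[ℂ] H => ⟪x, T y⟫_ℂ) key
  simpa [ContinuousLinearMap.adjoint_inner_right, inner_smul_right] using this

/-- Families with the same Gram matrix are related by an isometry. -/
theorem exists_isometry_of_gram {κ : Type*} {v : κ → H} {w : κ → K}
    (hv : Dense (Submodule.span ℂ (Set.range v) : Set H))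
    (h : ∀ j k, ⟪w j, w k⟫_ℂ = ⟪v j, v k⟫_ℂ) :
    ∃ V : H →L[ℂ] K, (∀ k, V (v k) = w k) ∧ ∀ x y, ⟪V x, V y⟫_ℂ = ⟪x, y⟫_ℂ := by
  let e := Finsupp.linearCombination ℂ v
  let f := Finsupp.linearCombination ℂ w
  have hd : DenseRange e := by
    rw [DenseRange, ← LinearMap.coe_range, Finsupp.range_linearCombination]
    exact hv
  -- The family `v` may have linear relations. Equality of norms sends them to relations among the
  -- `w k`, so `f` factors through `e`.
  have hn : ∀ a, ‖f a‖ ≤ 1 * ‖e a‖ := fun a => by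
    have : ⟪f a, f a⟫_ℂ = ⟪e a, e a⟫_ℂ := by
      simp only [e, f, Finsupp.linearCombination_apply, Finsupp.sum, sum_inner, inner_sum,
        inner_smul_left, inner_smul_right, h]
    rw [one_mul, @norm_eq_sqrt_re_inner ℂ, @norm_eq_sqrt_re_inner ℂ, this]
  have hV : ∀ k, f.extendOfNorm e (v k) = w k := fun k => by
    have := LinearMap.extendOfNorm_eq (f := f) hd ⟨1, hn⟩ (Finsupp.single k 1)
    simpa [e, f] using this
  refine ⟨f.extendOfNorm e, hV, fun x y => ?_⟩
  rw [inner_map_of_gram hv (f.extendOfNorm e) 1 (fun j k => by rw [hV, hV, h, one_mul]), one_mul]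

end Total

/-! ### The Gelfand–Naimark–Segal representation of a state -/

section GNS

universe v

variable {A : Type*} [CStarAlgebra A]

/-- The spectral order serves only to regard `φ` as a positive map. Cyclicity of `ξ` is not
recorded: the intertwiners constructed below start from the cyclic vector of the other
representation. -/
theorem exists_gns {A : Type v} [CStarAlgebra A] {φ : A →ₗ[ℂ] ℂ} (hφ : ∀ a, 0 ≤ φ (star a * a)) :
    ∃ (K : Type v) (_ : NormedAddCommGroup K) (_ : InnerProductSpace ℂ K) (_ : CompleteSpace K)
      (ρ : A →⋆ₐ[ℂ] (K →L[ℂ] K)) (ξ : K), ∀ a, φ a = ⟪ξ, ρ a ξ⟫_ℂ := by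
  let _ : PartialOrder A := CStarAlgebra.spectralOrder A
  have : StarOrderedRing A := CStarAlgebra.spectralOrderedRing A
  let f : A →ₚ[ℂ] ℂ := PositiveLinearMap.mk₀ φ fun a ha => by
    obtain ⟨b, rfl⟩ := CStarAlgebra.nonneg_iff_eq_star_mul_self.1 ha
    exact hφ b
  refine ⟨f.GNS, inferInstance, inferInstance, inferInstance, f.gnsStarAlgHom,
    ((f.toPreGNS 1 : f.PreGNS) : f.GNS), fun a => ?_⟩
  have : φ a = f a := rfl
  rw [this]
  simp only [PositiveLinearMap.gnsStarAlgHom_apply]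
  simp [PositiveLinearMap.preGNS_inner_def]

variable {H : Type*} [NormedAddCommGroup H] [InnerProductSpace ℂ H] [CompleteSpace H]

theorem inner_map_map (π : A →⋆ₐ[ℂ] (H →L[ℂ] H)) (a b : A) (x y : H) :
    ⟪π a x, π b y⟫_ℂ = ⟪x, π (star a * b) y⟫_ℂ := by
  rw [map_mul, map_star, ContinuousLinearMap.star_eq_adjoint, mul_apply_eq_comp,
    ContinuousLinearMap.adjoint_inner_right]

theorem vectorState_apply (π : A →⋆ₐ[ℂ] (H →L[ℂ] H)) (x : H) (a : A) :
    vectorState π x a = ⟪x, π a x⟫_ℂ := rfl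

theorem vectorState_mem_states (π : A →⋆ₐ[ℂ] (H →L[ℂ] H)) {x : H} (hx : ‖x‖ = 1) :
    vectorState π x ∈ states A := by
  refine ⟨fun a => ?_, ?_⟩
  · rw [vectorState_apply, ← inner_map_map, inner_self_eq_norm_sq_to_K]
    norm_cast
    exact Complex.zero_le_real.2 (sq_nonneg ‖π a x‖)
  · rw [vectorState_apply, map_one, one_apply_eq_self, inner_self_eq_norm_sq_to_K, hx]
    simp

variable {K : Type*} [NormedAddCommGroup K] [InnerProductSpace ℂ K] [CompleteSpace K]

/-- If the vector functional of `ξ` is dominated by the one of the cyclic vector `x`, there is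
a bounded intertwiner carrying `x` to `ξ`. -/
theorem exists_intertwiner (π : A →⋆ₐ[ℂ] (H →L[ℂ] H)) (ρ : A →⋆ₐ[ℂ] (K →L[ℂ] K)) {x : H} {ξ : K}
    (hx : Dense (Set.range fun a => π a x)) (C : ℝ) (h : ∀ a, ‖ρ a ξ‖ ≤ C * ‖π a x‖) :
    ∃ R : H →L[ℂ] K, R x = ξ ∧ ∀ a y, R (π a y) = ρ a (R y) := by
  let e : A →ₗ[ℂ] H := (ContinuousLinearMap.apply ℂ H x).toLinearMap ∘ₗ π.toAlgHom.toLinearMap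
  let f : A →ₗ[ℂ] K := (ContinuousLinearMap.apply ℂ K ξ).toLinearMap ∘ₗ ρ.toAlgHom.toLinearMap
  -- The bound makes `π a x ↦ ρ a ξ` well defined and bounded on the dense orbit of `x`.
  have hR : ∀ a, f.extendOfNorm e (π a x) = ρ a ξ :=
    LinearMap.extendOfNorm_eq (f := f) (e := e) hx ⟨C, h⟩
  refine ⟨f.extendOfNorm e, by simpa using hR 1, fun a y => ?_⟩
  refine hx.induction (P := fun y => f.extendOfNorm e (π a y) = ρ a (f.extendOfNorm e y)) ?_
    (isClosed_eq (by fun_prop) (by fun_prop)) y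
  rintro _ ⟨b, rfl⟩
  simp only [hR]
  rw [← mul_apply_eq_comp, ← map_mul, hR, map_mul, mul_apply_eq_comp]

end GNS

/-! ### Intertwiners of representations of universal C*-algebras -/

section Intertwiner

variable {H : Type*} [NormedAddCommGroup H] [InnerProductSpace ℂ H] [CompleteSpace H]
  {K : Type*} [NormedAddCommGroup K] [InnerProductSpace ℂ K] [CompleteSpace K]

theorem continuous_starAlgHom {A B : Type*} [CStarAlgebra A] [CStarAlgebra B] (π : A →⋆ₐ[ℂ] B) :
    Continuous π :=
  AddMonoidHomClass.continuous_of_bound π 1 fun a => by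
    rw [one_mul]; exact NonUnitalStarAlgHom.norm_apply_le π a

/-- An operator that intertwines the generators and their adjoints intertwines the
representations. -/
theorem UnivCStar.intertwines_of_gen {X : Type} {R : Set (FreeStarAlg X)}
    (π : UnivCStar R →⋆ₐ[ℂ] (H →L[ℂ] H)) (ρ : UnivCStar R →⋆ₐ[ℂ] (K →L[ℂ] K)) (V : H →L[ℂ] K)
    (h : ∀ x y, V (π (gen R x) y) = ρ (gen R x) (V y))
    (h' : ∀ x y, V (π (star (gen R x)) y) = ρ (star (gen R x)) (V y)) (a : UnivCStar R) :
    ∀ y, V (π a y) = ρ a (V y) := by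
  induction a using UnivCStar.induct_gen with
  | hc =>
    simp only [Set.ofPred_forall]
    exact isClosed_iInter fun y => isClosed_eq
      (V.continuous.comp ((ContinuousLinearMap.apply ℂ H y).continuous.comp
        (continuous_starAlgHom π)))
      ((ContinuousLinearMap.apply ℂ K (V y)).continuous.comp (continuous_starAlgHom ρ))
  | h₀ c =>
    intro y
    simp [Algebra.algebraMap_eq_smul_one]
  | h₁ x => exact h x
  | h₂ x => exact h' x
  | hm a b ha hb => intro y; simp only [map_mul, mul_apply_eq_comp, ha, hb]
  | ha a b ha hb => intro y; simp only [map_add, add_apply, ha, hb]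

/-- A closed subspace that is invariant under the generators and their adjoints is invariant. -/
theorem UnivCStar.invariant_of_gen {X : Type} {R : Set (FreeStarAlg X)}
    (π : UnivCStar R →⋆ₐ[ℂ] (H →L[ℂ] H)) {M : Submodule ℂ H} (hM : IsClosed (M : Set H))
    (h : ∀ x, ∀ y ∈ M, π (gen R x) y ∈ M) (h' : ∀ x, ∀ y ∈ M, π (star (gen R x)) y ∈ M)
    (a : UnivCStar R) : ∀ y ∈ M, π a y ∈ M := by
  induction a using UnivCStar.induct_gen with
  | hc =>
    simp only [Set.ofPred_forall]
    exact isClosed_iInter fun y => isClosed_iInter fun _ =>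
      hM.preimage ((ContinuousLinearMap.apply ℂ H y).continuous.comp (continuous_starAlgHom π))
  | h₀ c =>
    intro y hy
    have : π (algebraMap ℂ _ c) y = c • y := by
      simp [Algebra.algebraMap_eq_smul_one]
    rw [this]
    exact M.smul_mem c hy
  | h₁ x => exact h x
  | h₂ x => exact h' x
  | hm a b ha hb => intro y hy; rw [map_mul, mul_apply_eq_comp]; exact ha _ (hb y hy)
  | ha a b ha hb => intro y hy; rw [map_add, add_apply]; exact M.add_mem (ha y hy) (hb y hy)

end Intertwiner

/-- Isometries with complementary ranges have orthogonal ranges. -/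
theorem star_mul_eq_zero_of_range_sum {B : Type*} [CStarAlgebra B] {a b : B} (hb : star b * b = 1)
    (h : a * star a + b * star b = 1) : star a * b = 0 := by
  rw [← CStarRing.star_mul_self_eq_zero_iff, star_mul, star_star]
  -- Compressing the range relation by `b` gives `b* a a* b + 1 = 1`.
  have := congrArg (fun t => star b * t * b) h
  simp only [mul_add, add_mul, mul_one, hb] at this
  rw [show star b * (b * star b) * b = (star b * b) * (star b * b) by simp only [mul_assoc], hb,
    mul_one] at this
  simpa [mul_assoc] using this

/-! ### Words in the Cuntz isometries, Gram matrices and irreducibility. -/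

namespace CuntzO2

theorem relation_eq {a b : FreeStarAlg CuntzGen} (h : a - b ∈ cuntzRelations) :
    UnivCStar.mkHom cuntzRelations a = UnivCStar.mkHom cuntzRelations b := by
  rw [← sub_eq_zero, ← map_sub]
  exact UnivCStar.mkHom_eq_zero h

theorem star_S_mul_S (j : CuntzGen) : star (S j) * S j = 1 := by
  simpa only [S, UnivCStar.gen, map_mul, map_star, map_one] using relation_eq
    (a := star (FreeStarAlg.gen j) * FreeStarAlg.gen j) (b := 1)
    (by cases j <;> simp [cuntzRelations])

theorem range_sum : S .s1 * star (S .s1) + S .s2 * star (S .s2) = 1 := by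
  simpa only [S, UnivCStar.gen, map_add, map_mul, map_star, map_one] using relation_eq
    (a := FreeStarAlg.gen CuntzGen.s1 * star (FreeStarAlg.gen CuntzGen.s1) +
      FreeStarAlg.gen CuntzGen.s2 * star (FreeStarAlg.gen CuntzGen.s2)) (b := 1)
    (by simp [cuntzRelations])

theorem star_S_mul_S_of_ne {j k : CuntzGen} (h : j ≠ k) : star (S j) * S k = 0 := by
  cases j <;> cases k
  · exact absurd rfl h
  · exact star_mul_eq_zero_of_range_sum (star_S_mul_S _) range_sum
  · exact star_mul_eq_zero_of_range_sum (star_S_mul_S _) ((add_comm _ _).trans range_sum)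
  · exact absurd rfl h

/-- The product of generators along a word. -/
noncomputable def word (l : List CuntzGen) : CuntzO2 := (l.map S).prod

@[simp] theorem word_nil : word [] = 1 := rfl

@[simp] theorem word_cons (j : CuntzGen) (l : List CuntzGen) : word (j :: l) = S j * word l :=
  List.prod_cons

section Rep

variable {H : Type*} [NormedAddCommGroup H] [InnerProductSpace ℂ H] [CompleteSpace H]
  {K : Type*} [NormedAddCommGroup K] [InnerProductSpace ℂ K] [CompleteSpace K]

theorem inner_S_S (π : CuntzO2 →⋆ₐ[ℂ] (H →L[ℂ] H)) (j : CuntzGen) (a b : CuntzO2) (x y : H) :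
    ⟪π (S j * a) x, π (S j * b) y⟫_ℂ = ⟪π a x, π b y⟫_ℂ := by
  rw [inner_map_map, inner_map_map, star_mul, mul_assoc, ← mul_assoc _ (S j), star_S_mul_S, one_mul]

theorem inner_S_S_of_ne (π : CuntzO2 →⋆ₐ[ℂ] (H →L[ℂ] H)) {j k : CuntzGen} (hjk : j ≠ k)
    (a b : CuntzO2) (x y : H) : ⟪π (S j * a) x, π (S k * b) y⟫_ℂ = 0 := by
  rw [inner_map_map, star_mul, mul_assoc, ← mul_assoc _ (S k), star_S_mul_S_of_ne hjk]
  simp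

variable {i : CuntzGen} {π : CuntzO2 →⋆ₐ[ℂ] (H →L[ℂ] H)} {e : H}

/-- `S_j*` acts on a word by deleting its first letter or annihilating it. The fixed-point equation
supplies a first letter when the word is empty. -/
theorem map_word_eq_cons (he : π (S i) e = e) (l : List CuntzGen) :
    ∃ k m, π (word l) e = π (word (k :: m)) e := by
  cases l with
  | nil => exact ⟨i, [], by simp [he]⟩
  | cons k m => exact ⟨k, m, rfl⟩

/-- The Gram matrix of the words applied to a vector fixed by `S_i` is determined up to the norm
of the vector. -/
theorem inner_word_word (he : π (S i) e = e) (he1 : ‖e‖ = 1) {ρ : CuntzO2 →⋆ₐ[ℂ] (K →L[ℂ] K)}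
    {f : K} (hf : ρ (S i) f = f) (l m : List CuntzGen) :
    ⟪ρ (word l) f, ρ (word m) f⟫_ℂ = (‖f‖ : ℂ) ^ 2 * ⟪π (word l) e, π (word m) e⟫_ℂ := by
  have hf' : ∀ m, ⟪ρ (word []) f, ρ (word m) f⟫_ℂ =
      (‖f‖ : ℂ) ^ 2 * ⟪π (word []) e, π (word m) e⟫_ℂ := by
    intro m
    induction m with
    | nil => simp [he1]
    | cons k m ih =>
      -- The empty word is prolonged by `i` on both sides, so that first letters can be compared.
      -- The letter `k` is removed while the other word is empty again, and the induction on `m`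
      -- continues.
      have h1 : ρ (word []) f = ρ (S i * word []) f := by simp [hf]
      have h2 : π (word []) e = π (S i * word []) e := by simp [he]
      rw [h1, h2, word_cons]
      obtain rfl | hk := eq_or_ne i k
      · rw [inner_S_S, inner_S_S, ih]
      · rw [inner_S_S_of_ne _ hk, inner_S_S_of_ne _ hk, mul_zero]
  induction l generalizing m with
  | nil => exact hf' m
  | cons j l ih =>
    cases m with
    | nil =>
      rw [← inner_conj_symm, hf', ← inner_conj_symm (π (word (j :: l)) e)]
      simp
    | cons k m =>
      rw [word_cons, word_cons]
      obtain rfl | hk := eq_or_ne j k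
      · rw [inner_S_S, inner_S_S, ih]
      · rw [inner_S_S_of_ne _ hk, inner_S_S_of_ne _ hk, mul_zero]

/-- The words applied to a cyclic vector fixed by `S_i` span a dense subspace. -/
theorem dense_span_word (he : π (S i) e = e) (hc : Dense (Set.range fun a : CuntzO2 => π a e)) :
    Dense (Submodule.span ℂ (Set.range fun l => π (word l) e) : Set H) := by
  set M := Submodule.span ℂ (Set.range fun l => π (word l) e) with hM
  have key : ∀ T : H →L[ℂ] H, (∀ l, T (π (word l) e) ∈ M) →
      ∀ y ∈ M.topologicalClosure, T y ∈ M.topologicalClosure := fun T hT => by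
    have h1 : M ≤ M.topologicalClosure.comap T.toLinearMap := Submodule.span_le.2 (by
      rintro _ ⟨l, rfl⟩
      exact M.le_topologicalClosure (hT l))
    exact Submodule.topologicalClosure_minimal _ h1
      (M.isClosed_topologicalClosure.preimage T.continuous)
  have hmem : ∀ l, π (word l) e ∈ M := fun l => Submodule.subset_span ⟨l, rfl⟩
  have hinv := UnivCStar.invariant_of_gen π M.isClosed_topologicalClosure
    (fun j => key _ fun l => by
      rw [← mul_apply_eq_comp, ← map_mul]
      exact hmem (j :: l))
    (fun j => key _ fun l => by
      obtain ⟨k, m, h⟩ := map_word_eq_cons he l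
      rw [h, ← mul_apply_eq_comp, ← map_mul, word_cons, ← mul_assoc]
      change π (star (S j) * S k * word m) e ∈ M
      obtain rfl | hk := eq_or_ne j k
      · rw [star_S_mul_S, one_mul]; exact hmem m
      · rw [star_S_mul_S_of_ne hk]; simp)
  refine fun y => closure_minimal ?_ M.isClosed_topologicalClosure (hc y)
  rintro _ ⟨a, rfl⟩
  exact hinv a e (M.le_topologicalClosure (by simpa using hmem []))

/-- An operator that intertwines the isometries `S_j` intertwines the representations. -/
theorem intertwines_of_S (π : CuntzO2 →⋆ₐ[ℂ] (H →L[ℂ] H)) (ρ : CuntzO2 →⋆ₐ[ℂ] (K →L[ℂ] K))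
    (V : H →L[ℂ] K) (h : ∀ j y, V (π (S j) y) = ρ (S j) (V y)) (a : CuntzO2) (y : H) :
    V (π a y) = ρ a (V y) := by
  refine UnivCStar.intertwines_of_gen π ρ V h (fun j y => ?_) a y
  change V (π (star (S j)) y) = ρ (star (S j)) (V y)
  -- Applying `V` to this decomposition and then `ρ(S_j)*` leaves only the `j`-th term. The Cuntz
  -- relation thus makes `V` intertwine the adjoints as well.
  have hy : π (S .s1) (π (star (S .s1)) y) + π (S .s2) (π (star (S .s2)) y) = y := by
    simp only [← mul_apply_eq_comp, ← map_mul, ← add_apply, ← map_add, range_sum]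
    simp
  have h1 : ∀ k z, ρ (star (S k)) (ρ (S k) z) = z := fun k z => by
    rw [← mul_apply_eq_comp, ← map_mul, star_S_mul_S]; simp
  have h2 : ∀ {k l} z, k ≠ l → ρ (star (S k)) (ρ (S l) z) = 0 := fun z hkl => by
    rw [← mul_apply_eq_comp, ← map_mul, star_S_mul_S_of_ne hkl]; simp
  conv_rhs => rw [← hy]
  simp only [map_add, h]
  cases j
  · rw [h1, h2 _ (by simp), add_zero]
  · rw [h1, h2 _ (by simp), zero_add]

/-- An intertwiner multiplies inner products by the square of the norm of the image of the cyclic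
fixed unit vector. -/
theorem inner_intertwiner (he : π (S i) e = e) (he1 : ‖e‖ = 1)
    (hc : Dense (Set.range fun a : CuntzO2 => π a e)) {ρ : CuntzO2 →⋆ₐ[ℂ] (K →L[ℂ] K)}
    {R : H →L[ℂ] K} (hR : ∀ a y, R (π a y) = ρ a (R y)) (x y : H) :
    ⟪R x, R y⟫_ℂ = (‖R e‖ : ℂ) ^ 2 * ⟪x, y⟫_ℂ :=
  inner_map_of_gram (dense_span_word he hc) R _
    (fun l m => by
      simp only [hR]
      exact inner_word_word he he1 (by rw [← hR, he]) l m) x y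

/-- Two representations with unit vectors fixed by `S_i`, the first of which is cyclic, are
related by an isometric intertwiner. -/
theorem exists_isometric_intertwiner (he : π (S i) e = e) (he1 : ‖e‖ = 1)
    (hc : Dense (Set.range fun a : CuntzO2 => π a e)) (ρ : CuntzO2 →⋆ₐ[ℂ] (K →L[ℂ] K)) {f : K}
    (hf : ρ (S i) f = f) (hf1 : ‖f‖ = 1) :
    ∃ V : H →L[ℂ] K, V e = f ∧ (∀ a y, V (π a y) = ρ a (V y)) ∧
      ∀ x y, ⟪V x, V y⟫_ℂ = ⟪x, y⟫_ℂ := by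
  obtain ⟨V, hV, hVi⟩ := exists_isometry_of_gram (v := fun l => π (word l) e)
    (w := fun l => ρ (word l) f) (dense_span_word he hc)
    (fun l m => by rw [inner_word_word he he1 hf, hf1]; simp)
  refine ⟨V, by simpa using hV [], intertwines_of_S π ρ V fun j => ?_, hVi⟩
  have : V ∘L π (S j) = ρ (S j) ∘L V := by
    refine ContinuousLinearMap.ext_on (dense_span_word he hc) ?_
    rintro _ ⟨l, rfl⟩
    have := hV (j :: l)
    simp only [word_cons, map_mul, mul_apply_eq_comp] at this
    simp only [ContinuousLinearMap.comp_apply, hV, this]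
  exact fun y => congrArg (fun T : H →L[ℂ] K => T y) this

/-- Every nonzero vector is cyclic. -/
theorem dense_range_of_ne_zero (he : π (S i) e = e) (he1 : ‖e‖ = 1)
    (hc : Dense (Set.range fun a : CuntzO2 => π a e)) {x : H} (hx : x ≠ 0) :
    Dense (Set.range fun a : CuntzO2 => π a x) := by
  let N : Submodule ℂ H := LinearMap.range
    ((ContinuousLinearMap.apply ℂ H x).toLinearMap ∘ₗ π.toAlgHom.toLinearMap)
  have hN : (N : Set H) = Set.range fun a : CuntzO2 => π a x := rfl
  let M := N.topologicalClosure
  have hMc : IsClosed (M : Set H) := N.isClosed_topologicalClosure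
  have : CompleteSpace M := hMc.completeSpace_coe
  have hM : ∀ a, ∀ v ∈ M, π a v ∈ M := fun a => by
    have : N ≤ M.comap (π a).toLinearMap := by
      rintro _ ⟨b, rfl⟩
      refine N.le_topologicalClosure ⟨a * b, ?_⟩
      change π (a * b) x = π a (π b x)
      rw [map_mul, mul_apply_eq_comp]
    exact Submodule.topologicalClosure_minimal _ this (hMc.preimage (π a).continuous)
  -- The projection onto the closure `M` of the orbit of `x` is an intertwiner from `π` to its
  -- restriction to `M`.
  have hint : ∀ a y, M.orthogonalProjectionOnto (π a y) =
      subrep π M hM a (M.orthogonalProjectionOnto y) :=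
    fun a y => by
      refine ext_inner_right ℂ fun z => ?_
      have h1 : subrep π M hM a = star (subrep π M hM (star a)) := by rw [← map_star, star_star]
      rw [h1, ContinuousLinearMap.star_eq_adjoint, ContinuousLinearMap.adjoint_inner_left,
        Submodule.inner_orthogonalProjectionOnto_eq_of_mem_right,
        Submodule.inner_orthogonalProjectionOnto_eq_of_mem_right]
      change _ = ⟪y, π (star a) z⟫_ℂ
      rw [map_star, ContinuousLinearMap.star_eq_adjoint, ContinuousLinearMap.adjoint_inner_right]
  have hin := inner_intertwiner he he1 hc (ρ := subrep π M hM)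
    (R := M.orthogonalProjectionOnto) hint
  have hxM : x ∈ M := N.le_topologicalClosure ⟨1, by simp⟩
  have hx' : M.orthogonalProjectionOnto x = ⟨x, hxM⟩ :=
    M.orthogonalProjectionOnto_mem_subspace_eq_self ⟨x, hxM⟩
  -- The scaling constant can be read off at `x`, which is nonzero and fixed by the projection.
  have h1 : (‖M.orthogonalProjectionOnto e‖ : ℂ) ^ 2 = 1 := by
    have := hin x x
    rw [hx'] at this
    exact (mul_eq_right₀ (inner_self_ne_zero.2 hx)).1 this.symm
  have htop : M = ⊤ := by
    rw [← Submodule.orthogonal_eq_bot_iff, Submodule.eq_bot_iff]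
    intro y hy
    have := hin y y
    rw [h1, one_mul, Submodule.orthogonalProjectionOnto_apply_of_mem_orthogonal hy,
      inner_zero_left] at this
    exact inner_self_eq_zero.1 this.symm
  rw [← hN, Submodule.dense_iff_topologicalClosure_eq_top]
  exact htop

end Rep

end CuntzO2

/-! ### Purity of the vector states of `O₂`. -/

section VectorState

variable {A : Type*} [CStarAlgebra A] {H : Type*} [NormedAddCommGroup H] [InnerProductSpace ℂ H]
  [CompleteSpace H]

theorem vectorState_star_mul_self (π : A →⋆ₐ[ℂ] (H →L[ℂ] H)) (x : H) (a : A) :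
    vectorState π x (star a * a) = (‖π a x‖ : ℂ) ^ 2 := by
  rw [vectorState_apply, ← inner_map_map, inner_self_eq_norm_sq_to_K]
  rfl

end VectorState

namespace CuntzO2

variable {H : Type*} [NormedAddCommGroup H] [InnerProductSpace ℂ H] [CompleteSpace H]
  {i : CuntzGen} {π : CuntzO2 →⋆ₐ[ℂ] (H →L[ℂ] H)} {e : H}

/-- The vector states of a representation generated by a vector fixed by `S_i` are pure. -/
theorem vectorState_mem_pureStates (he : π (S i) e = e) (he1 : ‖e‖ = 1)
    (hc : Dense (Set.range fun a : CuntzO2 => π a e)) {x : H} (hx : ‖x‖ = 1) :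
    vectorState π x ∈ pureStates CuntzO2 := by
  refine ⟨vectorState_mem_states π hx, fun φ hφ ψ hψ h => ?_⟩
  obtain ⟨s, t, hs, ht, -, hst⟩ := h
  have hx0 : x ≠ 0 := norm_ne_zero_iff.1 (by rw [hx]; exact one_ne_zero)
  obtain ⟨K, _, _, _, ρ, ξ, hξ⟩ := exists_gns hφ.1
  -- From `s φ + t ψ = ω_x` and `ψ ≥ 0` one gets `s φ(a* a) ≤ ‖π a x‖²`, whence the constant `√s⁻¹`.
  have hbound : ∀ a, ‖ρ a ξ‖ ≤ √s⁻¹ * ‖π a x‖ := fun a => by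
    have h1 : φ (star a * a) = (‖ρ a ξ‖ : ℂ) ^ 2 := by
      rw [← vectorState_star_mul_self, vectorState_apply, hξ]
    have h2 := congrArg (fun ω : CuntzO2 →ₗ[ℂ] ℂ => (ω (star a * a)).re) hst
    have h3 : 0 ≤ (ψ (star a * a)).re := (Complex.nonneg_iff.1 (hψ.1 a)).1
    simp only [vectorState_star_mul_self, LinearMap.add_apply, LinearMap.smul_apply, h1,
      Complex.add_re, Complex.smul_re, ← Complex.ofReal_pow, Complex.ofReal_re, smul_eq_mul] at h2
    rw [← Real.sqrt_sq (norm_nonneg (π a x)), ← Real.sqrt_mul (inv_nonneg.2 hs.le)]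
    refine Real.le_sqrt_of_sq_le ?_
    rw [inv_mul_eq_div, le_div_iff₀ hs]
    nlinarith [mul_nonneg ht.le h3]
  obtain ⟨R, hRx, hR⟩ :=
    exists_intertwiner π ρ (dense_range_of_ne_zero he he1 hc hx0) _ hbound
  have key : ∀ a, φ a = (‖R e‖ : ℂ) ^ 2 * vectorState π x a := fun a => by
    rw [hξ, ← hRx, ← hR, inner_intertwiner he he1 hc hR, vectorState_apply]
  -- Both functionals take the value `1` at `1`, so the factor is `1`.
  have h1 := key 1
  rw [hφ.2, (vectorState_mem_states π hx).2, mul_one] at h1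
  ext a
  rw [key, ← h1, one_mul]

end CuntzO2

/-! ### Pairs satisfying the relations of `Q₂` -/

/-- The relations of the generators of `Q₂`. -/
structure IsTwoAdicPair {B : Type*} [Ring B] [StarRing B] (u s : B) : Prop where
  star_mul_u : star u * u = 1
  mul_star_u : u * star u = 1
  star_mul_s : star s * s = 1
  semiconj : s * u = u ^ 2 * s
  range_sum : s * star s + u * s * star s * star u = 1

namespace IsTwoAdicPair

variable {B : Type*} [CStarAlgebra B] {u s : B}

/-- The symmetry `u ↦ u*`, `s ↦ us`. -/
theorem symm (h : IsTwoAdicPair u s) : IsTwoAdicPair (star u) (u * s) where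
  star_mul_u := by rw [star_star, h.mul_star_u]
  mul_star_u := by rw [star_star, h.star_mul_u]
  star_mul_s := by
    rw [star_mul, mul_assoc, ← mul_assoc (star u), h.star_mul_u, one_mul, h.star_mul_s]
  semiconj := by
    have h1 : star u ^ 2 * u = star u := by rw [sq, mul_assoc, h.star_mul_u, mul_one]
    have h2 : star u * u ^ 2 = u := by rw [sq, ← mul_assoc, h.star_mul_u, one_mul]
    have h3 : s = u ^ 2 * s * star u := by rw [← h.semiconj, mul_assoc, h.mul_star_u, mul_one]
    rw [← mul_assoc, h1]
    conv_rhs => rw [h3]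
    rw [← mul_assoc, ← mul_assoc, h2]
  range_sum := by
    rw [star_star, star_mul,
      show star u * (u * s) * (star s * star u) * u = (star u * u) * (s * star s) * (star u * u) by
        simp only [mul_assoc], h.star_mul_u, one_mul, mul_one,
      show u * s * (star s * star u) = u * s * star s * star u by simp only [mul_assoc], add_comm,
      h.range_sum]

/-- The range relation says that `s` and `us` satisfy the Cuntz relations, so their ranges are
orthogonal. -/
theorem star_s_mul (h : IsTwoAdicPair u s) : star s * (u * s) = 0 :=
  star_mul_eq_zero_of_range_sum h.symm.star_mul_s (by
    rw [star_mul, ← mul_assoc (u * s), h.range_sum])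

/-- The unitary `u` as a unit. -/
def unit (h : IsTwoAdicPair u s) : Bˣ := ⟨u, star u, h.mul_star_u, h.star_mul_u⟩

theorem symm_unit (h : IsTwoAdicPair u s) : h.symm.unit = h.unit⁻¹ := Units.ext rfl

theorem star_unit_zpow (h : IsTwoAdicPair u s) (k : ℤ) :
    star ((h.unit ^ k : Bˣ) : B) = ((h.unit ^ (-k) : Bˣ) : B) := by
  have h1 : star h.unit = h.unit⁻¹ := Units.ext rfl
  rw [← Units.coe_star, star_zpow, h1, inv_zpow, zpow_neg]

theorem s_mul_zpow (h : IsTwoAdicPair u s) (k : ℤ) :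
    s * ((h.unit ^ k : Bˣ) : B) = ((h.unit ^ (2 * k) : Bˣ) : B) * s := by
  have : SemiconjBy s (h.unit : B) ((h.unit ^ 2 : Bˣ) : B) := h.semiconj
  have := this.units_zpow_right k
  rwa [← zpow_natCast, ← zpow_mul] at this

end IsTwoAdicPair

/-! ### Orthogonality of the powers of `u` applied to a vector fixed by `s`. -/

section Orthonormal

variable {K : Type*} [NormedAddCommGroup K] [InnerProductSpace ℂ K] [CompleteSpace K]
  {u s : K →L[ℂ] K} {f : K}

/-- The exponent is halved repeatedly, using `u^(2m) f = u^(2m) s f = s u^m f`. For even `n = 2m`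
the isometry `s`, which fixes `f`, reduces the inner product to exponent `m`. For odd `n` the vector
`u^n f` lies in the range of `us`, which is orthogonal to the range of `s` and hence to `f`. -/
theorem IsTwoAdicPair.inner_pow_eq_zero (h : IsTwoAdicPair u s) (hf : s f = f) {n : ℕ}
    (hn : 0 < n) : ⟪f, (u ^ n) f⟫_ℂ = 0 := by
  have hs : ∀ m : ℕ, (u ^ (2 * m)) f = s ((u ^ m) f) := fun m => by
    have h1 : SemiconjBy s u (u ^ 2) := h.semiconj
    have h2 := congrArg (fun T : K →L[ℂ] K => T f) (h1.pow_right m)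
    simp only [mul_apply_eq_comp, ← pow_mul, hf] at h2
    exact h2.symm
  induction n using Nat.strong_induction_on with
  | _ n ih =>
    obtain ⟨m, rfl | rfl⟩ := n.even_or_odd'
    · rw [hs]
      nth_rewrite 1 [← hf]
      rw [← ContinuousLinearMap.adjoint_inner_left, ← ih m (by omega) (by omega)]
      congr 1
      have := congrArg (fun T : K →L[ℂ] K => T f) h.star_mul_s
      simpa [hf, ContinuousLinearMap.star_eq_adjoint] using this
    · rw [pow_succ', mul_apply_eq_comp, hs]
      nth_rewrite 1 [← hf]
      rw [← ContinuousLinearMap.adjoint_inner_right, ← ContinuousLinearMap.star_eq_adjoint,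
        ← mul_apply_eq_comp u, ← mul_apply_eq_comp, h.star_s_mul]
      simp

theorem IsTwoAdicPair.orthonormal_zpow (h : IsTwoAdicPair u s) (hf : s f = f) (hf1 : ‖f‖ = 1) :
    Orthonormal ℂ fun k : ℤ => ((h.unit ^ k : (K →L[ℂ] K)ˣ) : K →L[ℂ] K) f := by
  have key : ∀ j k : ℤ, ⟪((h.unit ^ j : (K →L[ℂ] K)ˣ) : K →L[ℂ] K) f,
      ((h.unit ^ k : (K →L[ℂ] K)ˣ) : K →L[ℂ] K) f⟫_ℂ =
      ⟪f, ((h.unit ^ (k - j) : (K →L[ℂ] K)ˣ) : K →L[ℂ] K) f⟫_ℂ := fun j k => by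
    rw [← ContinuousLinearMap.adjoint_inner_right, ← ContinuousLinearMap.star_eq_adjoint,
      h.star_unit_zpow, ← mul_apply_eq_comp, ← Units.val_mul, ← zpow_add, neg_add_eq_sub]
  have hlt : ∀ j k : ℤ, j < k → ⟪((h.unit ^ j : (K →L[ℂ] K)ˣ) : K →L[ℂ] K) f,
      ((h.unit ^ k : (K →L[ℂ] K)ˣ) : K →L[ℂ] K) f⟫_ℂ = 0 := fun j k hjk => by
    obtain ⟨n, hn⟩ := Int.eq_ofNat_of_zero_le (sub_nonneg.2 hjk.le)
    rw [key, hn, zpow_natCast, Units.val_pow_eq_pow_val]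
    exact h.inner_pow_eq_zero hf (by omega)
  rw [orthonormal_iff_ite]
  intro j k
  split_ifs with hjk
  · rw [key, hjk, sub_self, zpow_zero, Units.val_one, one_apply_eq_self,
      inner_self_eq_norm_sq_to_K, hf1]
    simp
  · obtain h1 | h1 := lt_or_gt_of_ne hjk
    · exact hlt j k h1
    · rw [← inner_conj_symm, hlt k j h1, map_zero]

end Orthonormal

/-! ### Representations of `Q₂` with a fixed vector -/

/-- The index of the basis vector of `ℓ²(ℤ)` fixed by `S_i`. -/
def fixedIndex : CuntzGen → ℤ
  | .s1 => -1
  | .s2 => 0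

theorem norm_stdBasis (k : ℤ) : ‖stdBasis k‖ = 1 := by
  rw [@norm_eq_sqrt_re_inner ℂ, inner_stdBasis]; simp

theorem cuntzCanonicalRep_s1_apply (k : ℤ) :
    cuntzCanonicalRep (CuntzO2.S .s1) (stdBasis k) = stdBasis (2 * k + 1) := by
  rw [cuntzCanonicalRep_s1, mul_apply_eq_comp, doubleZ_apply, shiftZ_apply]

theorem cuntzCanonicalRep_s2_apply (k : ℤ) :
    cuntzCanonicalRep (CuntzO2.S .s2) (stdBasis k) = stdBasis (2 * k) := by
  rw [cuntzCanonicalRep_s2, doubleZ_apply]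

theorem cuntzCanonicalRep_fixed (i : CuntzGen) :
    cuntzCanonicalRep (CuntzO2.S i) (stdBasis (fixedIndex i)) = stdBasis (fixedIndex i) := by
  cases i
  · exact cuntzCanonicalRep_s1_apply _
  · exact cuntzCanonicalRep_s2_apply _

theorem dense_span_stdBasis : Dense (Submodule.span ℂ (Set.range stdBasis) : Set L2Z) := by
  rw [Submodule.dense_iff_topologicalClosure_eq_top, Submodule.topologicalClosure_eq_top_iff,
    Submodule.eq_bot_iff]
  intro y hy
  refine ext_inner fun k => ?_
  rw [inner_zero_right]
  exact hy _ (Submodule.subset_span ⟨k, rfl⟩)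

namespace TwoAdicQ2

theorem U_mul_star_U : U * star U = 1 := by
  simpa only [U, UnivCStar.gen, map_mul, map_star, map_one] using relation_eq
    (a := FreeStarAlg.gen TwoAdicGen.u * star (FreeStarAlg.gen TwoAdicGen.u)) (b := 1)
    (by simp [twoAdicRelations])

theorem S₂_mul_U : S₂ * U = U ^ 2 * S₂ := by
  have := relation_eq
    (a := FreeStarAlg.gen TwoAdicGen.s * FreeStarAlg.gen TwoAdicGen.u)
    (b := FreeStarAlg.gen TwoAdicGen.u ^ 2 * FreeStarAlg.gen TwoAdicGen.s)
    (by simp [twoAdicRelations])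
  rwa [map_mul, map_mul, map_pow] at this

theorem isTwoAdicPair {B : Type*} [CStarAlgebra B] (ρ : TwoAdicQ2 →⋆ₐ[ℂ] B) :
    IsTwoAdicPair (ρ U) (ρ S₂) where
  star_mul_u := by rw [← map_star, ← map_mul, star_U_mul_U, map_one]
  mul_star_u := by rw [← map_star, ← map_mul, U_mul_star_U, map_one]
  star_mul_s := by rw [← map_star, ← map_mul, star_S₂_mul_S₂, map_one]
  semiconj := by rw [← map_pow, ← map_mul, ← map_mul, S₂_mul_U]
  range_sum := by
    simp only [← map_star, ← map_mul, ← map_add]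
    rw [range_sum, map_one]

variable {H : Type*} [NormedAddCommGroup H] [InnerProductSpace ℂ H] [CompleteSpace H]
  {K : Type*} [NormedAddCommGroup K] [InnerProductSpace ℂ K] [CompleteSpace K]

/-- An operator that intertwines `U` and `S₂` intertwines the representations. -/
theorem intertwines_of_U_S₂ (π : TwoAdicQ2 →⋆ₐ[ℂ] (H →L[ℂ] H)) (ρ : TwoAdicQ2 →⋆ₐ[ℂ] (K →L[ℂ] K))
    (V : H →L[ℂ] K) (hU : ∀ y, V (π U y) = ρ U (V y)) (hS : ∀ y, V (π S₂ y) = ρ S₂ (V y))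
    (a : TwoAdicQ2) (y : H) : V (π a y) = ρ a (V y) := by
  refine UnivCStar.intertwines_of_gen π ρ V (fun j => ?_) (fun j => ?_) a y
  · cases j
    · exact hU
    · exact hS
  · cases j
    · intro y
      change V (π (star U) y) = ρ (star U) (V y)
      have h1 : π U (π (star U) y) = y := by
        rw [← mul_apply_eq_comp, ← map_mul, U_mul_star_U]; simp
      have h2 : ∀ z, ρ (star U) (ρ U z) = z := fun z => by
        rw [← mul_apply_eq_comp, ← map_mul, star_U_mul_U]; simp
      conv_rhs => rw [← h1, hU, h2]
    · intro y
      change V (π (star S₂) y) = ρ (star S₂) (V y)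
      -- For a non-unitary isometry the complement of the range matters; it is the range of `U S₂`,
      -- which `V` intertwines too. So the argument for the Cuntz algebra applies.
      have := CuntzO2.intertwines_of_S (π.comp cuntzInclusion) (ρ.comp cuntzInclusion) V
        (fun j z => by
          simp only [StarAlgHom.comp_apply]
          cases j
          · simp only [cuntzInclusion_s1, map_mul, mul_apply_eq_comp, hU, hS]
          · simp only [cuntzInclusion_s2, hS]) (star (CuntzO2.S .s2)) y
      simpa only [StarAlgHom.comp_apply, map_star, cuntzInclusion_s2] using this

/-- A unit vector fixed by `S_i` in a representation of `Q₂` generates a copy of the canonical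
representation. -/
theorem exists_isometric_intertwiner (ρ : TwoAdicQ2 →⋆ₐ[ℂ] (K →L[ℂ] K)) {i : CuntzGen} {f : K}
    (hf : ρ (cuntzInclusion (CuntzO2.S i)) f = f) (hf1 : ‖f‖ = 1) :
    ∃ W : L2Z →L[ℂ] K, W (stdBasis (fixedIndex i)) = f ∧
      (∀ a y, W (canonicalRep a y) = ρ a (W y)) ∧ ∀ x y, ⟪W x, W y⟫_ℂ = ⟪x, y⟫_ℂ := by
  have hp := isTwoAdicPair ρ
  -- The exponent is shifted so that `f` sits at the index that `S_i` fixes in `ℓ²(ℤ)`.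
  let w : ℤ → K := fun k => ((hp.unit ^ (k - fixedIndex i) : (K →L[ℂ] K)ˣ) : K →L[ℂ] K) f
  have hw : Orthonormal ℂ w := by
    cases i
    · rw [cuntzInclusion_s1, map_mul] at hf
      -- Here `U S₂` fixes `f`, so the symmetric pair `(U*, U S₂)` is used; the sign change turns
      -- powers of `U*` back into powers of `U`.
      have := (hp.symm.orthonormal_zpow hf hf1).comp (fun k : ℤ => -(k - fixedIndex .s1))
        (fun a b hab => by simpa using hab)
      simpa only [hp.symm_unit, inv_zpow', neg_neg, Function.comp_def] using! this
    · rw [cuntzInclusion_s2] at hf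
      exact (hp.orthonormal_zpow hf hf1).comp (fun k : ℤ => k - fixedIndex .s2)
        (fun a b hab => by simpa using hab)
  -- One formula for both cases: `U S₂ f = f` means `S₂ f = U⁻¹ f`. With `c = fixedIndex i` it gives
  -- `S₂ w_k = U^(2(k-c)) S₂ f = U^(2k-c) f = w_{2k}`.
  have hS : ρ S₂ f = ((hp.unit ^ fixedIndex i : (K →L[ℂ] K)ˣ) : K →L[ℂ] K) f := by
    cases i
    · rw [cuntzInclusion_s1, map_mul, mul_apply_eq_comp] at hf
      conv_rhs => rw [← hf]
      change _ = (star (ρ U)) _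
      rw [← mul_apply_eq_comp, hp.star_mul_u, one_apply_eq_self]
    · rw [cuntzInclusion_s2] at hf
      rw [hf]
      simp [fixedIndex]
  obtain ⟨W, hW, hWi⟩ := exists_isometry_of_gram (w := w) dense_span_stdBasis fun j k => by
    rw [inner_stdBasis]
    exact orthonormal_iff_ite.1 hw j k
  have ext : ∀ {S T : L2Z →L[ℂ] K}, (∀ k, S (stdBasis k) = T (stdBasis k)) → ∀ y, S y = T y :=
    fun {S T} h y => by
      have : S = T :=
        ContinuousLinearMap.ext_on dense_span_stdBasis (by rintro _ ⟨k, rfl⟩; exact h k)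
      rw [this]
  refine ⟨W, by rw [hW]; simp [w], intertwines_of_U_S₂ _ ρ W
    (ext (S := W ∘L canonicalRep U) (T := ρ U ∘L W) fun k => ?_)
    (ext (S := W ∘L canonicalRep S₂) (T := ρ S₂ ∘L W) fun k => ?_), hWi⟩
  · rw [ContinuousLinearMap.comp_apply, ContinuousLinearMap.comp_apply, canonicalRep_U,
      shiftZ_apply, hW, hW]
    change _ = ((hp.unit : (K →L[ℂ] K)ˣ) : K →L[ℂ] K) (w k)
    rw [← mul_apply_eq_comp, ← Units.val_mul, ← zpow_one_add]
    change ((hp.unit ^ (k + 1 - fixedIndex i) : (K →L[ℂ] K)ˣ) : K →L[ℂ] K) f = _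
    congr 3
    ring
  · rw [ContinuousLinearMap.comp_apply, ContinuousLinearMap.comp_apply, canonicalRep_S₂,
      doubleZ_apply, hW, hW]
    change ((hp.unit ^ (2 * k - fixedIndex i) : (K →L[ℂ] K)ˣ) : K →L[ℂ] K) f =
      ρ S₂ (((hp.unit ^ (k - fixedIndex i) : (K →L[ℂ] K)ˣ) : K →L[ℂ] K) f)
    rw [← mul_apply_eq_comp, hp.s_mul_zpow, mul_apply_eq_comp, hS, ← mul_apply_eq_comp,
      ← Units.val_mul, ← zpow_add]
    congr 3
    ring

end TwoAdicQ2

/-! ### The unique extension property -/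

section Extension

variable {H : Type*} [NormedAddCommGroup H] [InnerProductSpace ℂ H] [CompleteSpace H]
  {i : CuntzGen} {π : CuntzO2 →⋆ₐ[ℂ] (H →L[ℂ] H)} {e : H}

/-- A vector state of a representation generated by a vector fixed by `S_i` has only one extension
to a state of `Q₂`, and it is a vector state of the canonical representation. -/
theorem exists_vectorState_extension (he : π (CuntzO2.S i) e = e) (he1 : ‖e‖ = 1)
    (hc : Dense (Set.range fun a : CuntzO2 => π a e)) {x : H} (hx : ‖x‖ = 1) :
    ∃ y : L2Z, ‖y‖ = 1 ∧
      (∀ T, vectorState canonicalRep y (cuntzInclusion T) = vectorState π x T) ∧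
      ∀ Ω ∈ states TwoAdicQ2, (∀ T, Ω (cuntzInclusion T) = vectorState π x T) →
        Ω = vectorState canonicalRep y := by
  have hx0 : x ≠ 0 := norm_ne_zero_iff.1 (by rw [hx]; exact one_ne_zero)
  obtain ⟨V₀, hV₀e, hV₀, hV₀i⟩ := CuntzO2.exists_isometric_intertwiner he he1 hc cuntzCanonicalRep
    (cuntzCanonicalRep_fixed i) (norm_stdBasis _)
  refine ⟨V₀ x, ?_, fun T => ?_, fun Ω hΩ hr => ?_⟩
  · rw [@norm_eq_sqrt_re_inner ℂ, hV₀i, ← @norm_eq_sqrt_re_inner ℂ, hx]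
  · have : canonicalRep (cuntzInclusion T) (V₀ x) = V₀ (π T x) := (hV₀ T x).symm
    rw [vectorState_apply, this, hV₀i, vectorState_apply]
  obtain ⟨K, _, _, _, ρ, ξ, hξ⟩ := exists_gns hΩ.1
  let ρ' : CuntzO2 →⋆ₐ[ℂ] (K →L[ℂ] K) := ρ.comp cuntzInclusion
  have hρ' : ∀ a, ρ' a = ρ (cuntzInclusion a) := fun _ => rfl
  -- Equality of norms holds, since `Ω` and `ω_x` agree on `a* a` for `a` in `O₂`.
  have hbound : ∀ a, ‖ρ' a ξ‖ ≤ 1 * ‖π a x‖ := fun a => by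
    have h1 : (‖ρ' a ξ‖ : ℂ) ^ 2 = (‖π a x‖ : ℂ) ^ 2 := by
      rw [← vectorState_star_mul_self, ← vectorState_star_mul_self, vectorState_apply, hρ', ← hξ,
        hr]
    rw [one_mul]
    refine (pow_le_pow_iff_left₀ (norm_nonneg _) (norm_nonneg _) two_ne_zero).1 ?_
    exact_mod_cast h1.le
  obtain ⟨V, hVx, hV⟩ :=
    exists_intertwiner π ρ' (CuntzO2.dense_range_of_ne_zero he he1 hc hx0) 1 hbound
  -- The scaling constant `‖V e‖²` is computed at `x`: both `x` and `ξ = V x` are unit vectors.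
  have hVe : ‖V e‖ = 1 := by
    have h1 := CuntzO2.inner_intertwiner he he1 hc hV x x
    have h2 := hξ 1
    rw [hΩ.2, map_one, one_apply_eq_self] at h2
    rw [hVx, ← h2, inner_self_eq_norm_sq_to_K, hx] at h1
    have h3 : ‖V e‖ ^ 2 = 1 := by
      have h4 : (1 : ℂ) = (‖V e‖ : ℂ) ^ 2 := by simpa using h1
      exact_mod_cast h4.symm
    exact (pow_eq_one_iff_of_nonneg (norm_nonneg _) two_ne_zero).1 h3
  obtain ⟨W, hWf, hW, hWi⟩ := TwoAdicQ2.exists_isometric_intertwiner ρ (i := i) (f := V e)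
    (by rw [← hρ', ← hV, he]) hVe
  -- Both sides intertwine `O₂` and agree at the cyclic vector `e`. Since `W` intertwines all of
  -- `Q₂`, this carries the computation of `Ω` over to `ℓ²(ℤ)`.
  have hVW : ∀ y, V y = W (V₀ y) := fun y => by
    refine hc.induction (P := fun y => V y = W (V₀ y)) ?_
      (isClosed_eq (by fun_prop) (by fun_prop)) y
    rintro _ ⟨a, rfl⟩
    simp only [hV, hV₀, hV₀e]
    change _ = W (canonicalRep (cuntzInclusion a) _)
    rw [hW, hWf, hρ']
  ext a
  rw [hξ, ← hVx, hVW, ← hW, hWi, vectorState_apply]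

theorem comp_cuntzInclusion_mem_states {Ω : TwoAdicQ2 →ₗ[ℂ] ℂ} (hΩ : Ω ∈ states TwoAdicQ2) :
    Ω ∘ₗ cuntzInclusion.toAlgHom.toLinearMap ∈ states CuntzO2 := by
  refine ⟨fun a => ?_, ?_⟩
  · change 0 ≤ Ω (cuntzInclusion (star a * a))
    rw [map_mul, map_star]
    exact hΩ.1 _
  · change Ω (cuntzInclusion 1) = 1
    rw [map_one, hΩ.2]

/-- If the extension is a convex combination of states `φ` and `ψ`, their restrictions decompose the
pure state `ω_x`. So `φ` also extends `ω_x`, and uniqueness among all states identifies it. -/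
theorem hasUniquePureExtension_vectorState (he : π (CuntzO2.S i) e = e) (he1 : ‖e‖ = 1)
    (hc : Dense (Set.range fun a : CuntzO2 => π a e)) {x : H} (hx : ‖x‖ = 1) :
    HasUniquePureExtension (vectorState π x) := by
  obtain ⟨y, hy, hext, huniq⟩ := exists_vectorState_extension he he1 hc hx
  refine ⟨vectorState canonicalRep y, ⟨⟨vectorState_mem_states _ hy, fun φ hφ ψ hψ h => ?_⟩, hext⟩,
    fun Ω hΩ => huniq Ω hΩ.1.1 hΩ.2⟩
  obtain ⟨s, t, hs, ht, hst, h⟩ := h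
  have := (CuntzO2.vectorState_mem_pureStates he he1 hc hx).2 (comp_cuntzInclusion_mem_states hφ)
    (comp_cuntzInclusion_mem_states hψ) ⟨s, t, hs, ht, hst, by
      ext T
      rw [← hext, ← h]
      rfl⟩
  exact huniq φ hφ fun T => congrArg (fun ω : CuntzO2 →ₗ[ℂ] ℂ => ω T) this

end Extension

/-! ### The representations `π₊` and `π₋` -/

section Permutative

/-- A representation that permutes an orthonormal basis, where every basis vector but `e_0` is the
image of an earlier one, is of type `P(i)` if `S_i` fixes `e_0`. -/
theorem isOfTypeP_subrep {s : Set ℤ} [CompleteSpace (basisSpan s)]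
    (hinv : ∀ a, ∀ v ∈ basisSpan s, cuntzCanonicalRep a v ∈ basisSpan s) (i : CuntzGen)
    (b : ℕ → ℤ) (hb : Function.Injective b) (hbs : Set.range b = s) (σ : CuntzGen → ℕ → ℕ)
    (hσ1 : ∀ n, b (σ .s1 n) = 2 * b n + 1) (hσ2 : ∀ n, b (σ .s2 n) = 2 * b n)
    (hσi : σ i 0 = 0) (hσ : ∀ n, 0 < n → ∃ j m, m < n ∧ σ j m = n) :
    IsOfTypeP i (subrep cuntzCanonicalRep (basisSpan s) hinv) := by
  set π := subrep cuntzCanonicalRep (basisSpan s) hinv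
  have hmem : ∀ n, b n ∈ s := fun n => hbs ▸ ⟨n, rfl⟩
  let v : ℕ → basisSpan s := fun n => ⟨stdBasis (b n), stdBasis_mem (hmem n)⟩
  have hv : Orthonormal ℂ v := by
    rw [orthonormal_iff_ite]
    intro j k
    change ⟪stdBasis (b j), stdBasis (b k)⟫_ℂ = _
    rw [inner_stdBasis]
    simp only [hb.eq_iff]
  have hsp : ⊤ ≤ (Submodule.span ℂ (Set.range v)).topologicalClosure := by
    rintro ⟨y, hy⟩ -
    have himg : ((↑) : basisSpan s → L2Z) '' (Submodule.span ℂ (Set.range v) : Set (basisSpan s)) =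
        Submodule.span ℂ (stdBasis '' s) := by
      have := Submodule.map_span (basisSpan s).subtype (Set.range v)
      rw [← Set.range_comp, show stdBasis '' s = Set.range ((basisSpan s).subtype ∘ v) by
        conv_lhs => rw [← hbs, ← Set.range_comp]
        rfl] at *
      exact congrArg (fun M : Submodule ℂ L2Z => (M : Set L2Z)) this
    change _ ∈ closure (Submodule.span ℂ (Set.range v) : Set (basisSpan s))
    -- Density is required inside the subspace, whereas `basisSpan s` is a closure in `ℓ²(ℤ)`; the
    -- subspace topology relates the two closures.
    rw [Topology.IsInducing.subtypeVal.closure_eq_preimage_closure_image]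
    exact (congrArg closure himg).symm.subset hy
  have hact : ∀ j n, π (CuntzO2.S j) (v n) = v (σ j n) := fun j n => by
    refine Subtype.ext ?_
    change cuntzCanonicalRep (CuntzO2.S j) (stdBasis (b n)) = stdBasis (b (σ j n))
    cases j
    · rw [cuntzCanonicalRep_s1_apply, hσ1]
    · rw [cuntzCanonicalRep_s2_apply, hσ2]
  -- Every basis vector is reached from `v 0` by a product of generators, because its index has a
  -- strictly smaller predecessor.
  have hcyc : ∀ n, ∃ a, π a (v 0) = v n := fun n => by
    induction n using Nat.strong_induction_on with
    | _ n ih =>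
      obtain rfl | hn := Nat.eq_zero_or_pos n
      · exact ⟨1, by simp⟩
      · obtain ⟨j, m, hm, rfl⟩ := hσ n hn
        obtain ⟨a, ha⟩ := ih m hm
        exact ⟨CuntzO2.S j * a, by rw [map_mul, mul_apply_eq_comp, ha, hact]⟩
  refine ⟨HilbertBasis.mk hv hsp, σ, fun j m n hmn => hb ?_, ?_, ?_, 0, ?_, ?_⟩
  · have := congrArg b hmn
    cases j
    · rw [hσ1, hσ1] at this; omega
    · rw [hσ2, hσ2] at this; omega
  · refine IsCompl.of_eq (Set.eq_empty_of_forall_notMem ?_) (Set.eq_univ_of_forall fun n => ?_)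
    · rintro _ ⟨⟨m, rfl⟩, n, hn⟩
      have := congrArg b hn
      rw [hσ1, hσ2] at this
      omega
    -- The index `0` has no smaller predecessor; it lies in the range of `σ i` because it is fixed.
    · obtain rfl | hn := Nat.eq_zero_or_pos n
      · cases i
        · exact Or.inl ⟨0, hσi⟩
        · exact Or.inr ⟨0, hσi⟩
      · obtain ⟨j, m, -, h⟩ := hσ n hn
        cases j
        · exact Or.inl ⟨m, h⟩
        · exact Or.inr ⟨m, h⟩
  · simpa using hact
  · simpa [hσi] using hact i 0
  · let N : Submodule ℂ (basisSpan s) := LinearMap.range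
      ((ContinuousLinearMap.apply ℂ _ (v 0)).toLinearMap ∘ₗ π.toAlgHom.toLinearMap)
    have hN : (Set.range fun a : CuntzO2 => π a (HilbertBasis.mk hv hsp 0)) = (N : Set _) := by
      rw [HilbertBasis.coe_mk]; rfl
    rw [hN, Submodule.dense_iff_topologicalClosure_eq_top, ← top_le_iff]
    refine hsp.trans (Submodule.topologicalClosure_mono (Submodule.span_le.2 ?_))
    rintro _ ⟨n, rfl⟩
    exact hcyc n

/-- Under `k = -1 - n` the map `k ↦ 2k + 1` becomes `n ↦ 2n` and `k ↦ 2k` becomes `n ↦ 2n + 1`. The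
two branches are interchanged relative to `piPlus`, so `S_1` fixes the vector of index `0`, namely
`e_{-1}`. -/
theorem isOfTypeP_piMinus : IsOfTypeP .s1 piMinus :=
  isOfTypeP_subrep _ .s1 (fun n => -1 - n) (fun m n h => by simpa using h)
    (by
      ext k
      simp only [Set.mem_range, Set.mem_ofPred_eq]
      exact ⟨by rintro ⟨n, rfl⟩; omega, fun h => ⟨(-1 - k).toNat, by omega⟩⟩)
    (fun j n => j.casesOn (2 * n) (2 * n + 1)) (fun n => by push_cast; ring)
    (fun n => by push_cast; ring) rfl (fun n hn => by
      obtain ⟨m, rfl | rfl⟩ := n.even_or_odd'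
      · exact ⟨.s1, m, by omega, rfl⟩
      · exact ⟨.s2, m, by omega, rfl⟩)

theorem isOfTypeP_piPlus : IsOfTypeP .s2 piPlus :=
  isOfTypeP_subrep _ .s2 (fun n => n) (fun m n h => by simpa using h)
    (by
      ext k
      simp only [Set.mem_range, Set.mem_ofPred_eq]
      exact ⟨by rintro ⟨n, rfl⟩; omega, fun h => ⟨k.toNat, by omega⟩⟩)
    (fun j n => j.casesOn (2 * n + 1) (2 * n)) (fun n => by push_cast; ring)
    (fun n => by push_cast; ring) rfl (fun n hn => by
      obtain ⟨m, rfl | rfl⟩ := n.even_or_odd'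
      · exact ⟨.s2, m, by omega, rfl⟩
      · exact ⟨.s1, m, by omega, rfl⟩)

end Permutative

theorem mainTheorem7 :
    IsOfTypeP .s1 piMinus ∧ IsOfTypeP .s2 piPlus ∧
    ∀ {H : Type*} [NormedAddCommGroup H] [InnerProductSpace ℂ H] [CompleteSpace H]
      (i : CuntzGen) (π : CuntzO2 →⋆ₐ[ℂ] (H →L[ℂ] H)), IsOfTypeP i π →
      ∀ x : H, ‖x‖ = 1 →
        vectorState π x ∈ pureStates CuntzO2 ∧ HasUniquePureExtension (vectorState π x) := by
  refine ⟨isOfTypeP_piMinus, isOfTypeP_piPlus, fun i π hπ x hx => ?_⟩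
  obtain ⟨e, σ, -, -, -, n, he, hc⟩ := hπ
  have he1 : ‖e n‖ = 1 := e.orthonormal.1 n
  exact ⟨CuntzO2.vectorState_mem_pureStates he he1 hc hx,
    hasUniquePureExtension_vectorState he he1 hc hx⟩
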